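/- Let \(N\ge 2\) and \(A,B>0\). There is a constant \(C>0\), depending only on \(N\), \(A\) and \(B\), with the following property. Let \(K:\mathbb R^N\to\mathbb R\) be a function (whose value at \(0\) is arbitrary) that is of class \(C^2\) on \(\mathbb R^N\setminus\{0\}\) and satisfies \[ |K(x)|\le \frac{A}{|x|^{N-1}},\qquad |D^2K(x)|\le \frac{B}{|x|^{N+1}}\qquad\text{for every } x\in\mathbb R^N\setminus\{0\}, \] where \(|D^2K(x)|\) is the operator norm of the bilinear form \(D^2K(x)\). Let \(\mu\) be a finite signed Borel measure on \(\mathbb R^N\), with total variation measure \(|\mu|\), let \[ \mathrm{Dom}(K*\mu)=\Bigl\{x\in\mathbb R^N:\int_{\mathbb R^N}|K(x-y)|\,d|\mu|(y)<\infty\Bigr\}, \] and let \(K*\mu(x)=\int_{\mathbb R^N}K(x-y)\,d\mu(y)\) for \(x\in\mathrm{Dom}(K*\mu)\). Then there exists a measurable function \(I:\mathbb R^N\to[0,\infty]\) in weak \(L^1(\mathbb R^N)\), that is, with \([I]_{L^1_w}:=\sup_{t>0}t\,|\{I>t\}|<\infty\), such that \[ |K*\mu(x)-K*\mu(y)|\le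 (I(x)+I(y))\,|x-y|\qquad\text{for all } x,y\in\mathrm{Dom}(K*\mu) \] (with \(\infty\cdot 0=0\)) and \[ [I]_{L^1_w}\le C\,|\mu|(\mathbb R^N). \] Moreover, almost every \(y\in\mathbb R^N\) belongs to \(\mathrm{Dom}(K*\mu)\), the function \(K*\mu\) is approximately differentiable at almost every \(y\in\mathbb R^N\), and its approximate derivative satisfies \[ |\mathrm{ap}\,D(K*\mu)(y)|\le 2I(y)\qquad\text{for almost every } y\in\mathbb R^N. \] Here a function \(v:D\to\mathbb R\) with \(D\subset\mathbb R^N\) has approximate derivative \(L\), a linear map \(\mathbb R^N\to\mathbb R\), at \(y\in D\) if for every \(\varepsilon>0\) the proportion of the ball \(B_r(y)\) that lies outside the set \(\{x\in D:|v(x)-v(y)-L(x-y)|\le\varepsilon|x-y|\}\) tends to \(0\) as \(r\to0^+\); \(|L|\) is the operator norm. -/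

import Mathlib

open MeasureTheory Set Filter Topology
open scoped ENNReal NNReal

namespace WeakL1

/-- The kernel class: `K` is `C²` on `ℝᴺ \ {0}`, with `|K(x)| ≤ A / |x|^(N-1)` and
`|D²K(x)| ≤ B / |x|^(N+1)` for every `x ≠ 0`. The value of `K` at `0` is not constrained. -/
def IsKernel {N : ℕ} (A B : ℝ) (K : EuclideanSpace ℝ (Fin N) → ℝ) : Prop :=
  ContDiffOn ℝ 2 K {0}ᶜ ∧
    (∀ x, x ≠ 0 → |K x| ≤ A / ‖x‖ ^ (N - 1)) ∧
    (∀ x, x ≠ 0 → ‖iteratedFDeriv ℝ 2 K x‖ ≤ B / ‖x‖ ^ (N + 1))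

/-- `Dom (K * μ)`, the set of points `x` with `∫ |K(x - y)| d|μ|(y) < ∞`. -/
def convDom {N : ℕ} (K : EuclideanSpace ℝ (Fin N) → ℝ)
    (μ : SignedMeasure (EuclideanSpace ℝ (Fin N))) : Set (EuclideanSpace ℝ (Fin N)) :=
  {x | ∫⁻ y, ‖K (x - y)‖ₑ ∂μ.totalVariation < ∞}

/-- The convolution `K * μ (x) = ∫ K(x - y) dμ(y)`, meaningful for `x ∈ convDom K μ`. -/
noncomputable def conv {N : ℕ} (K : EuclideanSpace ℝ (Fin N) → ℝ)
    (μ : SignedMeasure (EuclideanSpace ℝ (Fin N))) (x : EuclideanSpace ℝ (Fin N)) : ℝ :=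
  ∫ᵛ y, K (x - y) ∂<•μ

/-- The weak `L¹` (Marcinkiewicz) quasinorm `sup {t |{f > t}| : t > 0}` of a function
`f : ℝᴺ → [0, ∞]`. -/
noncomputable def weakL1Norm {N : ℕ} (f : EuclideanSpace ℝ (Fin N) → ℝ≥0∞) : ℝ≥0∞ :=
  ⨆ (t : ℝ≥0) (_ : 0 < t), (t : ℝ≥0∞) * volume {x | (t : ℝ≥0∞) < f x}

/-- Membership in the weak `L¹` space, for functions with values in `[0, ∞]`. -/
def MemWeakL1 {N : ℕ} (f : EuclideanSpace ℝ (Fin N) → ℝ≥0∞) : Prop :=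
  Measurable f ∧ weakL1Norm f < ∞

/-- `y` is a (Lebesgue) density point of `S`: the proportion of `B_r(y)` outside `S` tends to `0`
as `r → 0`. -/
def IsDensityPoint {N : ℕ} (S : Set (EuclideanSpace ℝ (Fin N)))
    (y : EuclideanSpace ℝ (Fin N)) : Prop :=
  Tendsto (fun r : ℝ => volume (Sᶜ ∩ Metric.ball y r) / volume (Metric.ball y r))
    (𝓝[>] 0) (𝓝 0)

/-- The function `f`, considered on the domain `D`, has approximate limit `c` at `y`: for every
`ε > 0`, `y` is a density point of `{x ∈ D : |f x - c| ≤ ε}`. In particular `y` has to be a density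
point of `D`. Values of `f` outside `D` are irrelevant. -/
def HasApproxLim {N : ℕ} (D : Set (EuclideanSpace ℝ (Fin N)))
    (f : EuclideanSpace ℝ (Fin N) → ℝ) (c : ℝ) (y : EuclideanSpace ℝ (Fin N)) : Prop :=
  ∀ ε : ℝ, 0 < ε → IsDensityPoint {x | x ∈ D ∧ |f x - c| ≤ ε} y

/-- The function `v`, considered on the domain `D`, has approximate derivative `L` at the point `y`
of `D`: the approximate limit of `(v x - v y - L (x - y)) / |x - y|` as `x → y` is `0`. -/
def HasApproxDeriv {N : ℕ} (D : Set (EuclideanSpace ℝ (Fin N)))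
    (v : EuclideanSpace ℝ (Fin N) → ℝ) (L : EuclideanSpace ℝ (Fin N) →L[ℝ] ℝ)
    (y : EuclideanSpace ℝ (Fin N)) : Prop :=
  y ∈ D ∧ HasApproxLim D (fun x => (v x - v y - L (x - y)) / ‖x - y‖) 0 y

end WeakL1

/-! The proof establishes, for every level `t > 0`, a weak type estimate: `K * μ` is `t`-Lipschitz on
`convDom K μ` off a set of measure at most `C |μ|(ℝᴺ) / t`. By homogeneity and the Jordan
decomposition it is enough to treat one fixed level and a positive finite measure `μ`.

At height `1` the Calderón–Zygmund decomposition is encoded as a transport plan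
(`exists_transport_plan`): the part of `μ` on a union of balls where it exceeds Lebesgue measure is
moved, at distances comparable to their radii, to a measure of bounded density. Off a dilation of
the balls, the second differences of `K` bound the increments of the resulting change of `K * μ` by
`|x - y| (F x + F y)`, where `F` is an integral of `|z - w| / |x - z|^(N+1)` and satisfies
`∫ F ≲ μ(ℝᴺ)`; hence the change is Lipschitz off a small set
(`exists_bounded_density_replacement`).

For a finite measure `γ = g dx` with `g` bounded, `g` is in `L²`. The Fourier multiplier
`|ξ| |𝓕 K(ξ)|` is bounded, as one sees by splitting `K` at the scale `1 / |ξ|` and using the bound on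
`K` for the inner part and the bound on `D²K` for the outer part (`exists_truncations`). Thus
`D(K * γ)` is controlled in `L²` by Plancherel's theorem, and a function with gradient in `L²` is
Lipschitz off a small set, where the maximal function of `|Df|²` is large
(`exists_enorm_sub_le_off_small_set`). To stay within compactly supported `C²` kernels, smooth
truncations are used, and the estimates are summed over a rapidly converging subsequence
(`exists_enorm_integral_mul_sub_le`).

The exceptional sets at the levels `2^k` combine to a single function `I` of weak `L¹` such that
`K * μ` is `s`-Lipschitz on `convDom K μ ∩ {I < s}` for every `s > 0` (`exists_weakL1_modulus`).
The pointwise inequality is immediate from this. For the approximate derivative, the restriction of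
`K * μ` to `{I < s}` is extended to a Lipschitz function on `ℝᴺ`, Rademacher's theorem is applied to
the extension, and almost every point of `{I < s}` is a density point of this set
(`ae_hasApproxDeriv_of_lipschitz_sublevel`). -/

namespace WeakL1

open Metric Module

/-! ### Balls selected by the Vitali covering theorem -/

section Covering

variable {E : Type*} [NormedAddCommGroup E] [InnerProductSpace ℝ E] [FiniteDimensional ℝ E]
  [MeasurableSpace E] [BorelSpace E]

theorem volume_closedBall_mul (a : E) {k r : ℝ} (hk : 0 ≤ k) (hr : 0 ≤ r) :
    volume (closedBall a (k * r)) =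
      ENNReal.ofReal (k ^ finrank ℝ E) * volume (closedBall a r) := by
  rw [Measure.addHaar_closedBall_mul _ _ hk hr, ← Measure.addHaar_closedBall_center volume a r]

theorem volume_closedBall_pos (a : E) {r : ℝ} (hr : 0 < r) : 0 < volume (closedBall a r) :=
  measure_closedBall_pos _ _ hr

/-- Large balls have volume larger than the total mass of `ν`. -/
theorem exists_radius_bound [Nontrivial E] (ν : Measure E) [IsFiniteMeasure ν] :
    ∃ R : ℝ, ∀ (x : E) (r : ℝ), volume (closedBall x r) < ν (closedBall x r) → r ≤ R := by
  have hn : finrank ℝ E ≠ 0 := (finrank_pos).ne'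
  have ht : Tendsto (fun r : ℝ => ENNReal.ofReal (r ^ finrank ℝ E) * volume (closedBall (0 : E) 1))
      atTop (𝓝 ∞) := by
    have h1 : Tendsto (fun r : ℝ => ENNReal.ofReal (r ^ finrank ℝ E)) atTop (𝓝 ∞) :=
      ENNReal.tendsto_ofReal_nhds_top.2 (tendsto_pow_atTop hn)
    have h2 := ENNReal.Tendsto.mul_const (b := volume (closedBall (0 : E) 1)) h1
      (Or.inl ENNReal.top_ne_zero)
    rwa [ENNReal.top_mul (volume_closedBall_pos (0 : E) one_pos).ne'] at h2
  have h3 := ht.eventually (lt_mem_nhds (measure_lt_top ν univ))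
  obtain ⟨R, hR⟩ := (h3.and (eventually_ge_atTop 0)).exists_forall_of_atTop
  refine ⟨R, fun x r h => ?_⟩
  by_contra! hc
  have h4 := (hR r hc.le).1
  rw [← Measure.addHaar_closedBall' volume x (hR r hc.le).2] at h4
  exact absurd (h.trans_le (measure_mono (subset_univ _))) (not_lt.2 h4.le)

/-- A Calderón–Zygmund type selection of balls at height `1`: the balls with centers `a ∈ u` and
radii `r a` are disjoint and have `ν`-mass at least their volume, their five-fold dilations have
`ν`-mass at most their volume, and a point outside these dilations is the center only of balls with
`ν`-mass at most their volume. -/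
theorem exists_disjoint_balls [Nontrivial E] (ν : Measure E) [IsFiniteMeasure ν] :
    ∃ (u : Set E) (r : E → ℝ), u.Countable ∧ (∀ a ∈ u, 0 < r a) ∧
      (u.PairwiseDisjoint fun a => closedBall a (r a)) ∧
      (∀ a ∈ u, volume (closedBall a (r a)) ≤ ν (closedBall a (r a))) ∧
      (∀ a ∈ u, ν (closedBall a (5 * r a)) ≤ volume (closedBall a (5 * r a))) ∧
      ∀ x, x ∉ ⋃ a ∈ u, closedBall a (5 * r a) →
        ∀ s, 0 < s → ν (closedBall x s) ≤ volume (closedBall x s) := by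
  obtain ⟨R, hR⟩ := exists_radius_bound ν
  set Λ : Set E := {x | ∃ s, 0 < s ∧ volume (closedBall x s) < ν (closedBall x s)} with hΛ
  -- The radius is chosen above half of the supremum, so that no larger dilation is admissible.
  have hr : ∀ x : E, ∃ s : ℝ, x ∈ Λ → (0 < s ∧ volume (closedBall x s) < ν (closedBall x s) ∧
      ν (closedBall x (5 * s)) ≤ volume (closedBall x (5 * s))) := by
    intro x
    by_cases hx : x ∈ Λ
    · let S : Set ℝ := {s | 0 < s ∧ volume (closedBall x s) < ν (closedBall x s)}
      have hne : S.Nonempty := hx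
      have hbdd : BddAbove S := ⟨R, fun s hs => hR x s hs.2⟩
      have hpos : 0 < sSup S := by
        obtain ⟨s, hs⟩ := hne
        exact hs.1.trans_le (le_csSup hbdd hs)
      obtain ⟨s, hs, hlt⟩ := exists_lt_of_lt_csSup hne (half_lt_self hpos)
      refine ⟨s, fun _ => ⟨hs.1, hs.2, ?_⟩⟩
      by_contra! hc
      have : 5 * s ≤ sSup S := le_csSup hbdd ⟨by linarith [hs.1], hc⟩
      linarith
    · exact ⟨0, fun h => absurd h hx⟩
  choose r hr using hr
  obtain ⟨u, huΛ, hdisj, hcov⟩ := Vitali.exists_disjoint_subfamily_covering_enlargement_closedBall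
    Λ (fun x => x) r R (fun x hx => hR x _ (hr x hx).2.1) 5 (by norm_num)
  refine ⟨u, r, ?_, fun a ha => (hr a (huΛ ha)).1, hdisj, fun a ha => (hr a (huΛ ha)).2.1.le,
    fun a ha => (hr a (huΛ ha)).2.2, ?_⟩
  · refine hdisj.countable_of_nonempty_interior fun a ha => ?_
    exact ⟨a, ball_subset_interior_closedBall (mem_ball_self (hr a (huΛ ha)).1)⟩
  · intro x hx s hs
    by_contra! hc
    have hxΛ : x ∈ Λ := ⟨s, hs, hc⟩
    obtain ⟨b, hb, hsub⟩ := hcov x hxΛ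
    exact hx (mem_biUnion hb (hsub (mem_closedBall_self (hr x hxΛ).1.le)))

theorem volume_biUnion_closedBall_le {u : Set E} {r : E → ℝ} (hu : u.Countable)
    (hr : ∀ a ∈ u, 0 < r a) (hd : u.PairwiseDisjoint fun a => closedBall a (r a))
    {ν : Measure E} (hv : ∀ a ∈ u, volume (closedBall a (r a)) ≤ ν (closedBall a (r a)))
    {k : ℝ} (hk : 0 ≤ k) :
    volume (⋃ a ∈ u, closedBall a (k * r a)) ≤ ENNReal.ofReal (k ^ finrank ℝ E) * ν univ := by
  have : Countable u := hu
  calc volume (⋃ a ∈ u, closedBall a (k * r a))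
      ≤ ∑' a : u, volume (closedBall (a : E) (k * r a)) := measure_biUnion_le _ hu _
    _ ≤ ∑' a : u, ENNReal.ofReal (k ^ finrank ℝ E) * ν (closedBall (a : E) (r a)) := by
        refine ENNReal.tsum_le_tsum fun a => ?_
        rw [volume_closedBall_mul _ hk (hr a a.2).le]
        exact mul_le_mul_right (hv a a.2) _
    _ = ENNReal.ofReal (k ^ finrank ℝ E) * ν (⋃ a ∈ u, closedBall a (r a)) := by
        rw [ENNReal.tsum_mul_left, measure_biUnion hu hd fun a _ => measurableSet_closedBall]
    _ ≤ _ := by gcongr; exact subset_univ _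

end Covering

/-! ### Lipschitz estimates off a small set for functions with square integrable gradient -/

section Gradient

variable {E : Type*} [NormedAddCommGroup E] [InnerProductSpace ℝ E] [FiniteDimensional ℝ E]
  [MeasurableSpace E] [BorelSpace E]

theorem setLIntegral_closedBall_segment (h : E → ℝ≥0∞) (x : E) {r τ : ℝ}
    (hτ : 0 < τ) :
    ∫⁻ z in closedBall x r, h (x + τ • (z - x)) =
      ENNReal.ofReal ((τ ^ finrank ℝ E)⁻¹) * ∫⁻ w in closedBall x (τ * r), h w := by
  have hmp : Measure.map (fun z : E => x + τ • (z - x)) volume =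
      ENNReal.ofReal ((τ ^ finrank ℝ E)⁻¹) • volume := by
    have h1 : (fun z : E => x + τ • (z - x)) = (fun y => x + y) ∘ (fun y => τ • y) ∘ (fun z => z - x) :=
      rfl
    rw [h1, ← Measure.map_map (by fun_prop) (by fun_prop), ← Measure.map_map (by fun_prop) (by fun_prop),
      (measurePreserving_sub_right volume x).map_eq, Measure.map_addHaar_smul _ hτ.ne',
      Measure.map_smul, (measurePreserving_add_left volume x).map_eq, abs_of_pos (by positivity)]
  have hemb : MeasurableEmbedding (fun z : E => x + τ • (z - x)) := by
    have h1 : (fun z : E => x + τ • (z - x)) =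
        (Homeomorph.addLeft x) ∘ (Homeomorph.smulOfNeZero τ hτ.ne') ∘ (Homeomorph.subRight x) := by
      ext z; rfl
    rw [h1]
    exact ((Homeomorph.measurableEmbedding _).comp ((Homeomorph.measurableEmbedding _).comp
      (Homeomorph.measurableEmbedding _)))
  have hpre : (fun z : E => x + τ • (z - x)) ⁻¹' (closedBall x (τ * r)) = closedBall x r := by
    ext z
    simp only [mem_preimage, mem_closedBall, dist_eq_norm, add_sub_cancel_left, norm_smul,
      Real.norm_eq_abs, abs_of_pos hτ]
    exact mul_le_mul_iff_right₀ hτ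
  rw [← hemb.lintegral_map (μ := volume.restrict (closedBall x r)) h, ← hpre, ← hemb.restrict_map, hmp,
    Measure.restrict_smul, lintegral_smul_measure, smul_eq_mul]

theorem enorm_sub_le_lintegral_segment {F : Type*} [NormedAddCommGroup F] [NormedSpace ℝ F]
    {f : F → ℝ} (hf : ContDiff ℝ 1 f) (x z : F) :
    ‖f z - f x‖ₑ ≤ ∫⁻ τ in Ioc (0 : ℝ) 1, ‖fderiv ℝ f (x + τ • (z - x))‖ₑ * ‖z - x‖ₑ := by
  have hder : ∀ τ ∈ uIcc (0 : ℝ) 1, HasDerivAt (fun τ : ℝ => f (x + τ • (z - x)))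
      (fderiv ℝ f (x + τ • (z - x)) (z - x)) τ := by
    intro τ _
    have h1 : HasDerivAt (fun τ : ℝ => x + τ • (z - x)) (z - x) τ := by
      simpa using ((hasDerivAt_id τ).smul_const (z - x)).const_add x
    exact ((hf.differentiable one_ne_zero _).hasFDerivAt).comp_hasDerivAt τ h1
  have hcont : Continuous fun τ : ℝ => fderiv ℝ f (x + τ • (z - x)) (z - x) := by
    have := hf.continuous_fderiv one_ne_zero
    fun_prop
  have h2 := intervalIntegral.integral_eq_sub_of_hasDerivAt hder (hcont.intervalIntegrable _ _)
  simp only [one_smul, add_sub_cancel, zero_smul, add_zero] at h2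
  rw [← h2, intervalIntegral.integral_of_le zero_le_one]
  refine (enorm_integral_le_lintegral_enorm _).trans (lintegral_mono fun τ => ?_)
  exact (fderiv ℝ f (x + τ • (z - x))).le_opENorm _

/-- If the average of `|Df|` over every ball centered at `x` is at most `c`, then the average of
`|f - f x|` over such a ball is at most `c` times its radius. -/
theorem lintegral_closedBall_enorm_sub_le {f : E → ℝ} (hf : ContDiff ℝ 1 f) {x : E} {c : ℝ≥0∞}
    (hx : ∀ s, 0 < s → ∫⁻ w in closedBall x s, ‖fderiv ℝ f w‖ₑ ≤ c * volume (closedBall x s))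
    {r : ℝ} (hr : 0 < r) :
    ∫⁻ z in closedBall x r, ‖f z - f x‖ₑ ≤ ENNReal.ofReal r * c * volume (closedBall x r) := by
  have hc := hf.continuous_fderiv one_ne_zero
  calc ∫⁻ z in closedBall x r, ‖f z - f x‖ₑ
      ≤ ∫⁻ z in closedBall x r, ∫⁻ τ in Ioc (0 : ℝ) 1,
          ‖fderiv ℝ f (x + τ • (z - x))‖ₑ * ENNReal.ofReal r := by
        refine setLIntegral_mono' measurableSet_closedBall fun z hz => ?_
        refine (enorm_sub_le_lintegral_segment hf x z).trans (lintegral_mono fun τ => ?_)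
        have : ‖z - x‖ₑ ≤ ENNReal.ofReal r := by
          rw [← ofReal_norm]
          exact ENNReal.ofReal_le_ofReal (mem_closedBall_iff_norm.1 hz)
        gcongr
    _ = ∫⁻ τ in Ioc (0 : ℝ) 1, ∫⁻ z in closedBall x r,
          ‖fderiv ℝ f (x + τ • (z - x))‖ₑ * ENNReal.ofReal r := by
        refine lintegral_lintegral_swap ?_
        refine (Continuous.measurable ?_).aemeasurable
        refine ENNReal.continuous_mul_const ENNReal.ofReal_ne_top |>.comp ?_
        refine continuous_enorm.comp (hc.comp ?_)
        fun_prop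
    _ ≤ ∫⁻ τ in Ioc (0 : ℝ) 1, ENNReal.ofReal r * c * volume (closedBall x r) := by
        refine setLIntegral_mono' measurableSet_Ioc fun τ hτ => ?_
        rw [lintegral_mul_const' _ _ ENNReal.ofReal_ne_top,
          setLIntegral_closedBall_segment (fun w => ‖fderiv ℝ f w‖ₑ) x hτ.1]
        calc _ ≤ ENNReal.ofReal ((τ ^ finrank ℝ E)⁻¹) * (c * volume (closedBall x (τ * r))) *
              ENNReal.ofReal r := by
              gcongr
              exact hx _ (mul_pos hτ.1 hr)
          _ = (ENNReal.ofReal ((τ ^ finrank ℝ E)⁻¹) * ENNReal.ofReal (τ ^ finrank ℝ E)) *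
              (ENNReal.ofReal r * c * volume (closedBall x r)) := by
              rw [volume_closedBall_mul _ hτ.1.le hr.le]; ring
          _ = _ := by
              have : τ ^ finrank ℝ E ≠ 0 := (pow_pos hτ.1 _).ne'
              rw [← ENNReal.ofReal_mul (by have := hτ.1; positivity), inv_mul_cancel₀ this,
                ENNReal.ofReal_one, one_mul]
    _ = _ := by simp

/-- If all averages of `|Df|` over balls centered at `x` or at `y` are at most `c`, then
`|f x - f y|` is bounded by a multiple of `c |x - y|`: both values are compared with those of `f`
on the ball whose diameter is the segment from `x` to `y`. -/
theorem enorm_sub_le_of_average_fderiv_le {f : E → ℝ} (hf : ContDiff ℝ 1 f) {x y : E} {c : ℝ≥0∞}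
    (hx : ∀ s, 0 < s → ∫⁻ w in closedBall x s, ‖fderiv ℝ f w‖ₑ ≤ c * volume (closedBall x s))
    (hy : ∀ s, 0 < s → ∫⁻ w in closedBall y s, ‖fderiv ℝ f w‖ₑ ≤ c * volume (closedBall y s)) :
    ‖f x - f y‖ₑ ≤ ENNReal.ofReal (2 ^ (finrank ℝ E + 1)) * c * ‖x - y‖ₑ := by
  rcases eq_or_ne x y with rfl | hxy
  · simp
  set r : ℝ := ‖x - y‖ with hrdef
  have hr : 0 < r := norm_pos_iff.2 (sub_ne_zero.2 hxy)
  set m : E := midpoint ℝ x y with hm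
  have hmx : dist m x = r / 2 := by
    rw [hm, dist_midpoint_left, dist_eq_norm, Real.norm_two]; ring
  have hmy : dist m y = r / 2 := by
    rw [hm, dist_midpoint_right, dist_eq_norm, Real.norm_two]; ring
  have hsx : closedBall m (2⁻¹ * r) ⊆ closedBall x r :=
    closedBall_subset_closedBall' (by rw [hmx]; linarith)
  have hsy : closedBall m (2⁻¹ * r) ⊆ closedBall y r :=
    closedBall_subset_closedBall' (by rw [hmy]; linarith)
  set V : ℝ≥0∞ := volume (closedBall m (2⁻¹ * r)) with hV
  have hV0 : V ≠ 0 := (volume_closedBall_pos m (by positivity)).ne'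
  have hVt : V ≠ ∞ := measure_closedBall_lt_top.ne
  have hvol : ∀ a : E, volume (closedBall a r) = ENNReal.ofReal (2 ^ finrank ℝ E) * V := by
    intro a
    rw [hV, ← volume_closedBall_mul m zero_le_two (by positivity : 0 ≤ 2⁻¹ * r),
      ← mul_assoc, mul_inv_cancel₀ two_ne_zero, one_mul, Measure.addHaar_closedBall_center volume a,
      Measure.addHaar_closedBall_center volume m]
  have hcont := hf.continuous
  have key : ‖f x - f y‖ₑ * V ≤
      (ENNReal.ofReal (2 ^ (finrank ℝ E + 1)) * c * ENNReal.ofReal r) * V := by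
    calc ‖f x - f y‖ₑ * V = ∫⁻ z in closedBall m (2⁻¹ * r), ‖f x - f y‖ₑ := by simp [hV]
      _ ≤ ∫⁻ z in closedBall m (2⁻¹ * r), (‖f z - f x‖ₑ + ‖f z - f y‖ₑ) := by
          refine lintegral_mono fun z => ?_
          have : f x - f y = (f z - f y) - (f z - f x) := by ring
          rw [this, add_comm]
          exact enorm_sub_le
      _ = (∫⁻ z in closedBall m (2⁻¹ * r), ‖f z - f x‖ₑ) +
            ∫⁻ z in closedBall m (2⁻¹ * r), ‖f z - f y‖ₑ := by
          refine lintegral_add_left ?_ _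
          exact (continuous_enorm.comp (hcont.sub continuous_const)).measurable
      _ ≤ (∫⁻ z in closedBall x r, ‖f z - f x‖ₑ) + ∫⁻ z in closedBall y r, ‖f z - f y‖ₑ := by
          gcongr
      _ ≤ ENNReal.ofReal r * c * volume (closedBall x r) +
            ENNReal.ofReal r * c * volume (closedBall y r) :=
          add_le_add (lintegral_closedBall_enorm_sub_le hf hx hr)
            (lintegral_closedBall_enorm_sub_le hf hy hr)
      _ = _ := by
          rw [hvol, hvol, pow_succ, ENNReal.ofReal_mul (by positivity), ENNReal.ofReal_ofNat]
          ring
  have := (ENNReal.mul_le_mul_iff_left hV0 hVt).1 key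
  rwa [hrdef, ofReal_norm] at this

/-- A function with square integrable gradient is Lipschitz with constant comparable to `s` off a
set of measure at most a multiple of `s⁻² ∫ |Df|²`, the set where the maximal function of `|Df|²`
exceeds `s²`. -/
theorem exists_enorm_sub_le_off_small_set [Nontrivial E] {f : E → ℝ} (hf : ContDiff ℝ 1 f)
    (hfin : ∫⁻ x, ‖fderiv ℝ f x‖ₑ ^ 2 ≠ ∞) {s : ℝ≥0} (hs : 0 < s) :
    ∃ G : Set E, MeasurableSet G ∧
      volume G ≤ ENNReal.ofReal (5 ^ finrank ℝ E) * ((∫⁻ x, ‖fderiv ℝ f x‖ₑ ^ 2) / (s : ℝ≥0∞) ^ 2) ∧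
      ∀ x ∉ G, ∀ y ∉ G,
        ‖f x - f y‖ₑ ≤ ENNReal.ofReal (2 ^ (finrank ℝ E + 2)) * s * ‖x - y‖ₑ := by
  have hs0 : (s : ℝ≥0∞) ≠ 0 := by exact_mod_cast hs.ne'
  have hc := hf.continuous_fderiv one_ne_zero
  have hm : Measurable fun x => ‖fderiv ℝ f x‖ₑ ^ 2 := (hc.enorm.measurable).pow_const 2
  set ν : Measure E := ((s : ℝ≥0∞) ^ 2)⁻¹ • volume.withDensity fun x => ‖fderiv ℝ f x‖ₑ ^ 2 with hν
  have hνu : ν univ = (∫⁻ x, ‖fderiv ℝ f x‖ₑ ^ 2) / (s : ℝ≥0∞) ^ 2 := by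
    rw [hν, Measure.smul_apply, withDensity_apply _ MeasurableSet.univ, setLIntegral_univ,
      smul_eq_mul, mul_comm, ENNReal.div_eq_inv_mul, mul_comm]
  have : IsFiniteMeasure ν := ⟨by
    rw [hνu]; exact ENNReal.div_lt_top hfin (pow_ne_zero _ hs0)⟩
  obtain ⟨u, r, hu, hr, hd, hv, -, hout⟩ := exists_disjoint_balls ν
  refine ⟨⋃ a ∈ u, closedBall a (5 * r a), .biUnion hu fun a _ => measurableSet_closedBall, ?_, ?_⟩
  · rw [← hνu]
    exact volume_biUnion_closedBall_le hu hr hd hv (by norm_num)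
  · have avg : ∀ x ∉ ⋃ a ∈ u, closedBall a (5 * r a), ∀ t, 0 < t →
        ∫⁻ w in closedBall x t, ‖fderiv ℝ f w‖ₑ ≤ (2 * s) * volume (closedBall x t) := by
      intro x hx t ht
      have h1 := hout x hx t ht
      rw [hν, Measure.smul_apply, withDensity_apply _ measurableSet_closedBall, smul_eq_mul,
        ← ENNReal.div_eq_inv_mul, ENNReal.div_le_iff (pow_ne_zero _ hs0) (by finiteness)] at h1
      -- `a ≤ s + a² / s` replaces the Cauchy-Schwarz inequality.
      have h2 : ∀ a : ℝ≥0∞, a ≤ s + (s : ℝ≥0∞)⁻¹ * a ^ 2 := by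
        intro a
        rcases le_total a s with h | h
        · exact h.trans le_self_add
        · calc a = (s : ℝ≥0∞)⁻¹ * (s * a) := by
                rw [← mul_assoc, ENNReal.inv_mul_cancel hs0 ENNReal.coe_ne_top, one_mul]
            _ ≤ (s : ℝ≥0∞)⁻¹ * (a * a) := by gcongr
            _ ≤ _ := by rw [sq]; exact le_add_self
      calc ∫⁻ w in closedBall x t, ‖fderiv ℝ f w‖ₑ
          ≤ ∫⁻ w in closedBall x t, ((s : ℝ≥0∞) + (s : ℝ≥0∞)⁻¹ * ‖fderiv ℝ f w‖ₑ ^ 2) :=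
            lintegral_mono fun w => h2 _
        _ = s * volume (closedBall x t) +
              (s : ℝ≥0∞)⁻¹ * ∫⁻ w in closedBall x t, ‖fderiv ℝ f w‖ₑ ^ 2 := by
            rw [lintegral_add_left measurable_const, lintegral_const_mul _ hm]
            simp
        _ ≤ s * volume (closedBall x t) +
              (s : ℝ≥0∞)⁻¹ * (volume (closedBall x t) * (s : ℝ≥0∞) ^ 2) := by gcongr
        _ = s * volume (closedBall x t) +
              ((s : ℝ≥0∞)⁻¹ * s) * (s * volume (closedBall x t)) := by ring
        _ = _ := by rw [ENNReal.inv_mul_cancel hs0 ENNReal.coe_ne_top]; ring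
    intro x hx y hy
    refine (enorm_sub_le_of_average_fderiv_le hf (avg x hx) (avg y hy)).trans_eq ?_
    rw [pow_succ _ (finrank ℝ E + 1), ENNReal.ofReal_mul (by positivity), ENNReal.ofReal_ofNat]
    ring

end Gradient

/-! ### The Calderón–Zygmund decomposition as a transport plan -/

section Transport

variable {E : Type*} [NormedAddCommGroup E] [InnerProductSpace ℝ E] [FiniteDimensional ℝ E]
  [MeasurableSpace E] [BorelSpace E]

/-- If `μ` is at most Lebesgue measure on all balls centered in `s`, then so is its restriction to
`s`. The set `s` need not be measurable. -/
theorem restrict_le_volume_of_closedBall_le {μ : Measure E} [IsFiniteMeasure μ] {s : Set E}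
    (h : ∀ x ∈ s, ∀ r, 0 < r → μ (closedBall x r) ≤ volume (closedBall x r)) :
    μ.restrict s ≤ volume := by
  refine Measure.le_iff.2 fun t ht => ?_
  rw [Measure.restrict_apply ht]
  refine le_trans ?_ (measure_mono (inter_subset_left : t ∩ s ⊆ t))
  refine (Besicovitch.vitaliFamily μ).measure_le_of_frequently_le volume
    Measure.AbsolutelyContinuous.rfl _ fun x hx => Filter.Eventually.frequently ?_
  refine VitaliFamily.mem_filterAt_iff _ |>.2 ⟨1, one_pos, ?_⟩
  rintro _ ⟨r, hr, rfl⟩ -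
  exact h x hx.2 r hr

/-- The Calderón–Zygmund decomposition at height `1` of a finite measure `μ`. The measure `μ'` is
the part of `μ` where it is at most Lebesgue measure; the plan `π` moves the remaining part of `μ`
to a measure that has bounded density as well, and it does so at distances that are small compared
to the distance from the points outside the small set `G`. -/
theorem exists_transport_plan [Nontrivial E] (μ : Measure E) [IsFiniteMeasure μ] :
    ∃ (G : Set E) (μ' : Measure E) (π : Measure (E × E)), MeasurableSet G ∧
      volume G ≤ ENNReal.ofReal (30 ^ finrank ℝ E) * μ univ ∧
      μ = μ' + π.fst ∧
      μ' + π.snd ≤ ENNReal.ofReal (5 ^ finrank ℝ E + 1) • volume ∧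
      ∀ x ∉ G, ∀ᵐ p ∂π, 4 * ‖p.1 - p.2‖ ≤ ‖x - p.1‖ := by
  obtain ⟨u, r, hu, hr, hd, hv, hup, hout⟩ := exists_disjoint_balls μ
  have : Countable u := hu
  let _ : Encodable u := Encodable.ofCountable u
  -- The sets `Q a` form a disjoint partition of the union of the enlarged balls. The plan spreads the
  -- mass of `Q a` uniformly over the ball of radius `r a`.
  let Q : u → Set E := fun a => closedBall (a : E) (5 * r a) \
    ⋃ (b : u) (_ : Encodable.encode b < Encodable.encode a), closedBall (b : E) (5 * r b)
  have hQm : ∀ a, MeasurableSet (Q a) := fun a => measurableSet_closedBall.diff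
    (.iUnion fun b => .iUnion fun _ => measurableSet_closedBall)
  have hQs : ∀ a, Q a ⊆ closedBall (a : E) (5 * r a) := fun a => sdiff_subset
  have hQd : Pairwise (Function.onFun Disjoint Q) := by
    have key : ∀ a b : u, Encodable.encode a < Encodable.encode b → Disjoint (Q a) (Q b) := by
      intro a b hab
      rw [Set.disjoint_left]
      intro z hza hzb
      exact hzb.2 (mem_iUnion₂.2 ⟨a, hab, hQs a hza⟩)
    intro a b hab
    rcases lt_or_gt_of_ne (fun h => hab (Encodable.encode_injective h)) with h | h
    · exact key a b h
    · exact (key b a h).symm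
  have hQU : ⋃ a, Q a = ⋃ a ∈ u, closedBall a (5 * r a) := by
    refine Subset.antisymm ?_ ?_
    · refine iUnion_subset fun a => (hQs a).trans ?_
      exact subset_biUnion_of_mem (u := fun a => closedBall a (5 * r a)) a.2
    · intro z hz
      obtain ⟨a, ha, hza⟩ := mem_iUnion₂.1 hz
      have hex : ∃ n, ∃ b : u, Encodable.encode b = n ∧ z ∈ closedBall (b : E) (5 * r b) :=
        ⟨_, ⟨a, ha⟩, rfl, hza⟩
      classical
      obtain ⟨b, hb, hzb⟩ := Nat.find_spec hex
      refine mem_iUnion.2 ⟨b, hzb, fun hc => ?_⟩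
      obtain ⟨c, hcb, hzc⟩ := mem_iUnion₂.1 hc
      exact Nat.find_min hex (hb ▸ hcb) ⟨c, rfl, hzc⟩
  have hr' : ∀ a : u, 0 < r a := fun a => hr a a.2
  have hB0 : ∀ a : u, volume (closedBall (a : E) (r a)) ≠ 0 :=
    fun a => (volume_closedBall_pos _ (hr' a)).ne'
  have hBt : ∀ a : u, volume (closedBall (a : E) (r a)) ≠ ∞ :=
    fun a => measure_closedBall_lt_top.ne
  let π : Measure (E × E) := Measure.sum fun a : u => (volume (closedBall (a : E) (r a)))⁻¹ •
    (μ.restrict (Q a)).prod (volume.restrict (closedBall (a : E) (r a)))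
  have hfst : π.fst = μ.restrict (⋃ a, Q a) := by
    rw [Measure.restrict_iUnion hQd hQm, Measure.fst, Measure.map_sum measurable_fst.aemeasurable]
    congr 1
    ext1 a
    rw [Measure.map_smul, Measure.map_fst_prod, smul_smul, Measure.restrict_apply_univ,
      ENNReal.inv_mul_cancel (hB0 a) (hBt a), one_smul]
  have hsnd : π.snd ≤ ENNReal.ofReal (5 ^ finrank ℝ E) • volume := by
    have h1 : π.snd = Measure.sum fun a : u => ((volume (closedBall (a : E) (r a)))⁻¹ * μ (Q a)) •
        volume.restrict (closedBall (a : E) (r a)) := by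
      rw [Measure.snd, Measure.map_sum measurable_snd.aemeasurable]
      congr 1
      ext1 a
      rw [Measure.map_smul, Measure.map_snd_prod, smul_smul, Measure.restrict_apply_univ]
    have h2 : ∀ a : u, (volume (closedBall (a : E) (r a)))⁻¹ * μ (Q a) ≤
        ENNReal.ofReal (5 ^ finrank ℝ E) := by
      intro a
      rw [← ENNReal.div_eq_inv_mul, ENNReal.div_le_iff (hB0 a) (hBt a),
        ← volume_closedBall_mul _ (by norm_num) (hr' a).le]
      exact (measure_mono (hQs a)).trans (hup a a.2)
    have h3 : Measure.sum (fun a : u => volume.restrict (closedBall (a : E) (r a))) ≤ volume := by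
      rw [← Measure.restrict_iUnion (fun (a b : u) hab => hd a.2 b.2 (fun h => hab (Subtype.ext h)))
        fun a : u => measurableSet_closedBall]
      exact Measure.restrict_le_self
    rw [h1]
    refine Measure.le_iff.2 fun s hs => ?_
    calc _ = ∑' a : u, ((volume (closedBall (a : E) (r a)))⁻¹ * μ (Q a)) *
              volume.restrict (closedBall (a : E) (r a)) s := by
            rw [Measure.sum_apply _ hs]; rfl
      _ ≤ ∑' a : u, ENNReal.ofReal (5 ^ finrank ℝ E) *
              volume.restrict (closedBall (a : E) (r a)) s :=
            ENNReal.tsum_le_tsum fun a => mul_le_mul_left (h2 a) _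
      _ = ENNReal.ofReal (5 ^ finrank ℝ E) *
            Measure.sum (fun a : u => volume.restrict (closedBall (a : E) (r a))) s := by
            rw [ENNReal.tsum_mul_left, Measure.sum_apply _ hs]
      _ ≤ _ := mul_le_mul_right (h3 s) _
  have hUm : MeasurableSet (⋃ a, Q a) := .iUnion hQm
  have hμ' : μ.restrict (⋃ a, Q a)ᶜ ≤ volume :=
    restrict_le_volume_of_closedBall_le fun x hx => hout x (by rwa [← hQU])
  refine ⟨⋃ a ∈ u, closedBall a (30 * r a), μ.restrict (⋃ a, Q a)ᶜ, π,
    .biUnion hu fun a _ => measurableSet_closedBall,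
    volume_biUnion_closedBall_le hu hr hd hv (by norm_num), ?_, ?_, ?_⟩
  · rw [hfst, add_comm, Measure.restrict_add_restrict_compl hUm]
  · refine (add_le_add hμ' hsnd).trans_eq ?_
    rw [ENNReal.ofReal_add (by positivity) zero_le_one, add_smul, ENNReal.ofReal_one, one_smul,
      add_comm]
  · intro x hx
    refine Measure.ae_sum_iff.2 fun a => Measure.ae_smul_measure ?_ _
    rw [Measure.prod_restrict]
    refine (ae_restrict_iff' ((hQm a).prod measurableSet_closedBall)).2 (.of_forall ?_)
    rintro ⟨z, w⟩ ⟨hz, hw⟩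
    have h1 : ‖z - a‖ ≤ 5 * r a := mem_closedBall_iff_norm.1 (hQs a hz)
    have h2 : ‖w - a‖ ≤ r a := mem_closedBall_iff_norm.1 hw
    have h3 : 30 * r a < ‖x - a‖ := by
      by_contra! hc
      exact hx (mem_biUnion a.2 (mem_closedBall_iff_norm.2 hc))
    have h4 : ‖z - w‖ ≤ ‖z - a‖ + ‖w - a‖ := by
      rw [show z - w = (z - a) - (w - a) by abel]; exact norm_sub_le _ _
    have h5 : ‖x - a‖ ≤ ‖x - z‖ + ‖z - a‖ := by
      rw [show x - (a : E) = (x - z) + (z - a) by abel]; exact norm_add_le _ _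
    have h6 := hr' a
    show 4 * ‖z - w‖ ≤ ‖x - z‖
    linarith

end Transport

/-! ### Pointwise estimates for kernels -/

section Kernel

variable {N : ℕ} {A B : ℝ} {K : EuclideanSpace ℝ (Fin N) → ℝ}

theorem IsKernel.contDiffAt (hK : IsKernel A B K) {x : EuclideanSpace ℝ (Fin N)} (hx : x ≠ 0) :
    ContDiffAt ℝ 2 K x :=
  hK.1.contDiffAt (isOpen_compl_singleton.mem_nhds hx)

theorem IsKernel.differentiableAt (hK : IsKernel A B K) {x : EuclideanSpace ℝ (Fin N)}
    (hx : x ≠ 0) : DifferentiableAt ℝ K x :=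
  (hK.contDiffAt hx).differentiableAt two_ne_zero

theorem IsKernel.differentiableAt_fderiv (hK : IsKernel A B K) {x : EuclideanSpace ℝ (Fin N)}
    (hx : x ≠ 0) : DifferentiableAt ℝ (fderiv ℝ K) x :=
  ((hK.contDiffAt hx).fderiv_right (m := 1) (by norm_num)).differentiableAt one_ne_zero

theorem IsKernel.norm_fderiv_fderiv_le (hK : IsKernel A B K) {x : EuclideanSpace ℝ (Fin N)}
    (hx : x ≠ 0) : ‖fderiv ℝ (fderiv ℝ K) x‖ ≤ B / ‖x‖ ^ (N + 1) := by
  rw [← norm_iteratedFDeriv_one, norm_iteratedFDeriv_fderiv]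
  exact hK.2.2 x hx

theorem IsKernel.norm_fderiv_sub_le (hK : IsKernel A B K) (hB : 0 ≤ B) {ρ : ℝ} (hρ : 0 < ρ)
    {a b : EuclideanSpace ℝ (Fin N)} (h : ∀ p ∈ segment ℝ a b, ρ ≤ ‖p‖) :
    ‖fderiv ℝ K b - fderiv ℝ K a‖ ≤ B / ρ ^ (N + 1) * ‖b - a‖ := by
  have h0 : ∀ p ∈ segment ℝ a b, p ≠ 0 := fun p hp => norm_pos_iff.1 (hρ.trans_le (h p hp))
  refine (convex_segment a b).norm_image_sub_le_of_norm_fderiv_le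
    (fun p hp => hK.differentiableAt_fderiv (h0 p hp)) (fun p hp => ?_)
    (left_mem_segment ℝ a b) (right_mem_segment ℝ a b)
  refine (hK.norm_fderiv_fderiv_le (h0 p hp)).trans ?_
  have := h p hp
  gcongr

/-- The bounds on `K` and `D²K` imply one on `DK`: Taylor expansion on a ball of radius `|x| / 2`
centered at `x`. -/
theorem IsKernel.norm_fderiv_le (hN : 0 < N) (hA : 0 ≤ A) (hB : 0 ≤ B) (hK : IsKernel A B K)
    {x : EuclideanSpace ℝ (Fin N)} (hx : x ≠ 0) :
    ‖fderiv ℝ K x‖ ≤ 2 ^ (N + 1) * (A + B) / ‖x‖ ^ N := by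
  obtain ⟨n, rfl⟩ : ∃ n, N = n + 1 := ⟨N - 1, by omega⟩
  have hxp : 0 < ‖x‖ := norm_pos_iff.2 hx
  set ρ := ‖x‖ with hρ
  have hball : ∀ p ∈ closedBall x (ρ / 2), ρ / 2 ≤ ‖p‖ := by
    intro p hp
    have h1 := mem_closedBall_iff_norm.1 hp
    have h2 := norm_sub_norm_le x p
    rw [norm_sub_rev] at h2
    linarith
  have h0 : ∀ p ∈ closedBall x (ρ / 2), p ≠ 0 :=
    fun p hp => norm_pos_iff.1 ((half_pos hxp).trans_le (hball p hp))
  have hx_mem : x ∈ closedBall x (ρ / 2) := mem_closedBall_self (half_pos hxp).le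
  set c : ℝ := 2 ^ (n + 1) * B / ρ ^ (n + 1) with hc
  have hder : ∀ p ∈ closedBall x (ρ / 2), ‖fderiv ℝ K p - fderiv ℝ K x‖ ≤ c := by
    intro p hp
    refine (hK.norm_fderiv_sub_le hB (half_pos hxp) fun q hq =>
      hball q ((convex_closedBall x (ρ / 2)).segment_subset hx_mem hp hq)).trans ?_
    calc B / (ρ / 2) ^ (n + 1 + 1) * ‖p - x‖ ≤ B / (ρ / 2) ^ (n + 1 + 1) * (ρ / 2) := by
          gcongr; exact mem_closedBall_iff_norm.1 hp
      _ = c := by rw [hc, div_pow]; field_simp; ring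
  have hKb : ∀ p ∈ closedBall x (ρ / 2), |K p| ≤ 2 ^ n * A / ρ ^ n := by
    intro p hp
    refine (hK.2.1 p (h0 p hp)).trans ?_
    calc A / ‖p‖ ^ (n + 1 - 1) ≤ A / (ρ / 2) ^ n := by
          rw [Nat.add_sub_cancel]; have := hball p hp; gcongr
      _ = _ := by rw [div_pow]; field_simp
  have hv : ∀ v : EuclideanSpace ℝ (Fin (n + 1)), ‖v‖ = ρ / 2 →
      ‖fderiv ℝ K x v‖ ≤ 2 ^ (n + 1 + 1) * (A + B) / ρ ^ (n + 1) * ‖v‖ := by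
    intro v hv
    have hmem : x + v ∈ closedBall x (ρ / 2) := by simp [hv]
    have h1 := (convex_closedBall x (ρ / 2)).norm_image_sub_le_of_norm_hasFDerivWithin_le'
      (f := K) (f' := fderiv ℝ K) (φ := fderiv ℝ K x) (C := c)
      (fun p hp => (hK.differentiableAt (h0 p hp)).hasFDerivAt.hasFDerivWithinAt) hder hx_mem hmem
    rw [add_sub_cancel_left] at h1
    have h2 := hKb _ hmem
    have h3 := hKb _ hx_mem
    have h4 : ‖fderiv ℝ K x v‖ ≤ |K (x + v)| + |K x| + c * ‖v‖ := by
      rw [Real.norm_eq_abs] at *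
      have h6 := abs_le.1 h1
      have h7 := abs_le.1 (le_refl |K (x + v)|)
      have h8 := abs_le.1 (le_refl |K x|)
      exact abs_le.2 ⟨by linarith [h6.1, h6.2, h7.1, h7.2, h8.1, h8.2],
        by linarith [h6.1, h6.2, h7.1, h7.2, h8.1, h8.2]⟩
    refine h4.trans ?_
    calc |K (x + v)| + |K x| + c * ‖v‖ ≤ 2 ^ n * A / ρ ^ n + 2 ^ n * A / ρ ^ n + c * ‖v‖ := by gcongr
      _ = (2 ^ (n + 1 + 1) * A + 2 ^ (n + 1) * B) / ρ ^ (n + 1) * (ρ / 2) := by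
          rw [hv, hc]; field_simp; ring
      _ ≤ _ := by
          rw [hv]
          gcongr
          rw [mul_add]
          gcongr
          · norm_num
          · omega
  refine ContinuousLinearMap.opNorm_le_bound _ (by positivity) fun v => ?_
  rcases eq_or_ne v 0 with rfl | hv0
  · simp
  have hvp : 0 < ‖v‖ := norm_pos_iff.2 hv0
  have h1 := hv ((ρ / 2 / ‖v‖) • v) (by
    rw [norm_smul, Real.norm_of_nonneg (by positivity)]; field_simp)
  rw [map_smul, norm_smul, norm_smul, Real.norm_of_nonneg (by positivity)] at h1
  have h2 : 0 < ρ / 2 / ‖v‖ := by positivity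
  refine le_of_mul_le_mul_left ?_ h2
  linarith

theorem norm_ge_of_mem_segment {ρ : ℝ} {a b : EuclideanSpace ℝ (Fin N)}
    (h : ρ + ‖b - a‖ ≤ ‖a‖) {p : EuclideanSpace ℝ (Fin N)} (hp : p ∈ segment ℝ a b) : ρ ≤ ‖p‖ := by
  have h1 : ‖p - a‖ ≤ ‖b - a‖ := norm_sub_le_of_mem_segment hp
  have h2 := norm_sub_norm_le a p
  rw [norm_sub_rev] at h2
  linarith

theorem IsKernel.abs_sub_le (hN : 0 < N) (hA : 0 ≤ A) (hB : 0 ≤ B) (hK : IsKernel A B K) {ρ : ℝ}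
    (hρ : 0 < ρ) {a b : EuclideanSpace ℝ (Fin N)} (h : ∀ p ∈ segment ℝ a b, ρ ≤ ‖p‖) :
    |K b - K a| ≤ 2 ^ (N + 1) * (A + B) / ρ ^ N * ‖b - a‖ := by
  have h0 : ∀ p ∈ segment ℝ a b, p ≠ 0 := fun p hp => norm_pos_iff.1 (hρ.trans_le (h p hp))
  rw [← Real.norm_eq_abs]
  refine (convex_segment a b).norm_image_sub_le_of_norm_fderiv_le
    (fun p hp => hK.differentiableAt (h0 p hp)) (fun p hp => ?_)
    (left_mem_segment ℝ a b) (right_mem_segment ℝ a b)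
  refine (hK.norm_fderiv_le hN hA hB (h0 p hp)).trans ?_
  have := h p hp
  gcongr

/-- The second difference of the kernel when `x` and `y` are close to each other compared to their
distance from `z`. -/
theorem IsKernel.abs_second_difference_le_of_near (hB : 0 ≤ B) (hK : IsKernel A B K)
    {x y z w : EuclideanSpace ℝ (Fin N)} (hxz : 0 < ‖x - z‖)
    (hx : 4 * ‖z - w‖ ≤ ‖x - z‖) (hxy : 4 * ‖x - y‖ ≤ ‖x - z‖) :
    |(K (x - z) - K (x - w)) - (K (y - z) - K (y - w))| ≤
      2 ^ (N + 1) * B * ‖x - y‖ * (‖z - w‖ / ‖x - z‖ ^ (N + 1)) := by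
  set ρ := ‖x - z‖ with hρ
  have hseg : ∀ p ∈ segment ℝ y x, ρ / 2 + ‖(p - w) - (p - z)‖ ≤ ‖p - z‖ := by
    intro p hp
    rw [segment_symm] at hp
    have h1 : ‖p - x‖ ≤ ‖y - x‖ := norm_sub_le_of_mem_segment hp
    rw [norm_sub_rev y x] at h1
    have h2 : ‖x - z‖ ≤ ‖p - x‖ + ‖p - z‖ := by
      rw [show x - z = (p - z) - (p - x) by abel, add_comm]; exact norm_sub_le _ _
    have h3 : (p - w) - (p - z) = z - w := by abel
    rw [h3]
    linarith
  have hpos : ∀ p ∈ segment ℝ y x, p - z ≠ 0 ∧ p - w ≠ 0 := fun p hp =>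
    ⟨norm_pos_iff.1 ((half_pos hxz).trans_le
        (norm_ge_of_mem_segment (hseg p hp) (left_mem_segment ℝ _ _))),
      norm_pos_iff.1 ((half_pos hxz).trans_le
        (norm_ge_of_mem_segment (hseg p hp) (right_mem_segment ℝ _ _)))⟩
  have hdiff : ∀ p ∈ segment ℝ y x, HasFDerivAt (fun p => K (p - z) - K (p - w))
      (fderiv ℝ K (p - z) - fderiv ℝ K (p - w)) p := by
    intro p hp
    have e1 := (hK.differentiableAt (hpos p hp).1).hasFDerivAt.comp p
      ((hasFDerivAt_id p).sub_const z)
    have e2 := (hK.differentiableAt (hpos p hp).2).hasFDerivAt.comp p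
      ((hasFDerivAt_id p).sub_const w)
    exact e1.sub e2
  have := (convex_segment y x).norm_image_sub_le_of_norm_hasFDerivWithin_le
    (C := B / (ρ / 2) ^ (N + 1) * ‖z - w‖) (fun p hp => (hdiff p hp).hasFDerivWithinAt)
    (fun p hp => ?_) (left_mem_segment ℝ y x) (right_mem_segment ℝ y x)
  · rw [← Real.norm_eq_abs]
    refine this.trans_eq ?_
    rw [div_pow]
    field_simp
  · rw [norm_sub_rev]
    refine (hK.norm_fderiv_sub_le hB (half_pos hxz) fun q hq =>
      norm_ge_of_mem_segment (hseg p hp) hq).trans_eq ?_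
    rw [show (p - w) - (p - z) = z - w by abel]

theorem IsKernel.abs_difference_le (hN : 0 < N) (hA : 0 ≤ A) (hB : 0 ≤ B) (hK : IsKernel A B K)
    {x z w : EuclideanSpace ℝ (Fin N)} (hxz : 0 < ‖x - z‖) (hx : 4 * ‖z - w‖ ≤ ‖x - z‖) {d : ℝ}
    (hd : ‖x - z‖ ≤ 4 * d) :
    |K (x - z) - K (x - w)| ≤
      2 ^ (2 * N + 3) * (A + B) * d * (‖z - w‖ / ‖x - z‖ ^ (N + 1)) := by
  have h1 : (x - w) - (x - z) = z - w := by abel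
  have h2 := hK.abs_sub_le hN hA hB (half_pos hxz) (a := x - z) (b := x - w) fun p hp =>
    norm_ge_of_mem_segment (by rw [h1]; linarith [norm_nonneg (z - w)]) hp
  rw [abs_sub_comm]
  refine h2.trans ?_
  rw [h1]
  calc _ = 2 ^ (2 * N + 1) * (A + B) * ‖x - z‖ * (‖z - w‖ / ‖x - z‖ ^ (N + 1)) := by
        rw [div_pow]
        field_simp
        ring
    _ ≤ 2 ^ (2 * N + 1) * (A + B) * (4 * d) * (‖z - w‖ / ‖x - z‖ ^ (N + 1)) := by gcongr
    _ = _ := by ring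

/-- The second difference of the kernel is bounded by `|x - y|` times the sum of two functions, one
of `x` and one of `y`. -/
theorem IsKernel.abs_second_difference_le (hN : 0 < N) (hA : 0 ≤ A) (hB : 0 ≤ B)
    (hK : IsKernel A B K) {x y z w : EuclideanSpace ℝ (Fin N)}
    (hx : 4 * ‖z - w‖ ≤ ‖x - z‖) (hy : 4 * ‖z - w‖ ≤ ‖y - z‖) :
    |(K (x - z) - K (x - w)) - (K (y - z) - K (y - w))| ≤
      2 ^ (2 * N + 3) * (A + B) * ‖x - y‖ *
        (‖z - w‖ / ‖x - z‖ ^ (N + 1) + ‖z - w‖ / ‖y - z‖ ^ (N + 1)) := by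
  rcases eq_or_ne z w with rfl | hzw
  · simp
  have hzw' : 0 < ‖z - w‖ := norm_pos_iff.2 (sub_ne_zero.2 hzw)
  have hxz : 0 < ‖x - z‖ := by linarith
  have hyz : 0 < ‖y - z‖ := by linarith
  have hc : (2 : ℝ) ^ (N + 1) * B ≤ 2 ^ (2 * N + 3) * (A + B) := by
    have h1 : (2 : ℝ) ^ (N + 1) ≤ 2 ^ (2 * N + 3) := pow_le_pow_right₀ one_le_two (by omega)
    exact mul_le_mul h1 (by linarith) hB (by positivity)
  have hnx : 0 ≤ ‖z - w‖ / ‖x - z‖ ^ (N + 1) := by positivity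
  have hny : 0 ≤ ‖z - w‖ / ‖y - z‖ ^ (N + 1) := by positivity
  by_cases h1 : 4 * ‖x - y‖ ≤ ‖x - z‖
  · refine (hK.abs_second_difference_le_of_near hB hxz hx h1).trans ?_
    gcongr
    linarith
  by_cases h2 : 4 * ‖x - y‖ ≤ ‖y - z‖
  · rw [norm_sub_rev x y] at h2 ⊢
    rw [abs_sub_comm]
    refine (hK.abs_second_difference_le_of_near hB hyz hy h2).trans ?_
    gcongr
    linarith
  · push Not at h1 h2
    refine (abs_sub _ _).trans ?_
    rw [mul_add]
    exact add_le_add (hK.abs_difference_le hN hA hB hxz hx h1.le)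
      (hK.abs_difference_le hN hA hB hyz hy h2.le)

end Kernel

/-! ### Integrals of powers of the norm -/

section Powers

/-- The surface area of the unit sphere of `ℝᴺ`. -/
noncomputable def sphereArea (N : ℕ) : ℝ≥0 :=
  N * (volume (ball (0 : EuclideanSpace ℝ (Fin N)) 1)).toNNReal

variable {N : ℕ}

theorem lintegral_fun_norm (hN : 0 < N) {f : ℝ → ℝ} (hf : ∀ y, 0 ≤ f y)
    (hi : IntegrableOn (fun y : ℝ => y ^ (N - 1) * f y) (Ioi 0)) :
    ∫⁻ x : EuclideanSpace ℝ (Fin N), ENNReal.ofReal (f ‖x‖) =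
      sphereArea N * ENNReal.ofReal (∫ y in Ioi (0 : ℝ), y ^ (N - 1) * f y) := by
  have : Nonempty (Fin N) := ⟨⟨0, hN⟩⟩
  have h1 : Integrable (fun x : EuclideanSpace ℝ (Fin N) => f ‖x‖) := by
    rw [integrable_fun_norm_addHaar volume (f := f), finrank_euclideanSpace_fin]
    exact hi
  rw [← ofReal_integral_eq_lintegral_ofReal h1 (.of_forall fun x => hf _),
    integral_fun_norm_addHaar volume f, finrank_euclideanSpace_fin, nsmul_eq_mul, smul_eq_mul,
    ← mul_assoc, ENNReal.ofReal_mul (by positivity)]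
  congr 1
  rw [ENNReal.ofReal_mul (by positivity), sphereArea]
  simp [Measure.real, ENNReal.ofReal]

theorem setLIntegral_closedBall_norm_pow_le (hN : 0 < N) {ρ : ℝ} (hρ : 0 ≤ ρ) :
    ∫⁻ x in closedBall (0 : EuclideanSpace ℝ (Fin N)) ρ, ENNReal.ofReal (1 / ‖x‖ ^ (N - 1)) ≤
      sphereArea N * ENNReal.ofReal ρ := by
  set f : ℝ → ℝ := (Iic ρ).indicator fun y => |1 / y ^ (N - 1)| with hfdef
  have hf : ∀ y, 0 ≤ f y := fun y => indicator_nonneg (fun _ _ => abs_nonneg _) _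
  have heq : EqOn (fun y : ℝ => y ^ (N - 1) * f y) ((Iic ρ).indicator fun _ => 1) (Ioi 0) := by
    intro y hy
    have hy' : (0 : ℝ) < y := hy
    by_cases h : y ∈ Iic ρ
    · simp only [hfdef, indicator_of_mem h]
      rw [abs_of_pos (by positivity)]
      field_simp
    · simp [hfdef, indicator_of_notMem h]
  have hi : IntegrableOn (fun y : ℝ => y ^ (N - 1) * f y) (Ioi 0) := by
    refine IntegrableOn.congr_fun ?_ heq.symm measurableSet_Ioi
    rw [IntegrableOn, integrable_indicator_iff measurableSet_Iic, IntegrableOn,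
      Measure.restrict_restrict measurableSet_Iic, inter_comm, Ioi_inter_Iic]
    exact integrableOn_const (by simp) (by simp)
  have h2 := lintegral_fun_norm hN hf hi
  rw [setIntegral_congr_fun measurableSet_Ioi heq, setIntegral_indicator measurableSet_Iic,
    Ioi_inter_Iic] at h2
  simp only [integral_const, smul_eq_mul, mul_one, measureReal_restrict_apply_univ] at h2
  rw [Real.volume_real_Ioc_of_le hρ, sub_zero] at h2
  rw [← h2, ← lintegral_indicator measurableSet_closedBall]
  refine lintegral_mono fun x => ?_
  by_cases h : x ∈ closedBall (0 : EuclideanSpace ℝ (Fin N)) ρ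
  · have h' : ‖x‖ ∈ Iic ρ := by simpa using h
    simp only [indicator_of_mem h, hfdef, indicator_of_mem h']
    exact ENNReal.ofReal_le_ofReal (le_abs_self _)
  · simp [indicator_of_notMem h]

theorem setLIntegral_compl_norm_pow_le (hN : 0 < N) {σ : ℝ} (hσ : 0 < σ) :
    ∫⁻ x in {x : EuclideanSpace ℝ (Fin N) | σ ≤ ‖x‖}, ENNReal.ofReal (1 / ‖x‖ ^ (N + 1)) ≤
      sphereArea N * ENNReal.ofReal (1 / σ) := by
  set f : ℝ → ℝ := (Ici σ).indicator fun y => |1 / y ^ (N + 1)| with hfdef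
  have hf : ∀ y, 0 ≤ f y := fun y => indicator_nonneg (fun _ _ => abs_nonneg _) _
  have heq : EqOn (fun y : ℝ => y ^ (N - 1) * f y) ((Ici σ).indicator fun y => y ^ (-2 : ℝ))
      (Ioi 0) := by
    intro y hy
    have hy' : (0 : ℝ) < y := hy
    by_cases h : y ∈ Ici σ
    · simp only [hfdef, indicator_of_mem h]
      rw [abs_of_pos (by positivity), Real.rpow_neg hy'.le, Real.rpow_ofNat,
        show N + 1 = (N - 1) + 2 by omega, pow_add]
      field_simp
    · simp [hfdef, indicator_of_notMem h]
  have hsub : Ioi 0 ∩ Ici σ = Ici σ := by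
    ext y; simp only [mem_inter_iff, mem_Ioi, mem_Ici]
    exact ⟨fun h => h.2, fun h => ⟨hσ.trans_le h, h⟩⟩
  have hi : IntegrableOn (fun y : ℝ => y ^ (N - 1) * f y) (Ioi 0) := by
    refine IntegrableOn.congr_fun ?_ heq.symm measurableSet_Ioi
    rw [IntegrableOn, integrable_indicator_iff measurableSet_Ici, IntegrableOn,
      Measure.restrict_restrict measurableSet_Ici, inter_comm, hsub]
    exact (integrableOn_Ici_iff_integrableOn_Ioi).2
      (integrableOn_Ioi_rpow_of_lt (by norm_num) hσ)
  have h2 := lintegral_fun_norm hN hf hi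
  rw [setIntegral_congr_fun measurableSet_Ioi heq, setIntegral_indicator measurableSet_Ici,
    hsub, integral_Ici_eq_integral_Ioi, integral_Ioi_rpow_of_lt (by norm_num) hσ] at h2
  have h3 : -σ ^ ((-2 : ℝ) + 1) / (-2 + 1) = 1 / σ := by
    rw [show (-2 : ℝ) + 1 = -1 by norm_num, Real.rpow_neg_one]; ring
  rw [h3] at h2
  have hms : MeasurableSet {x : EuclideanSpace ℝ (Fin N) | σ ≤ ‖x‖} :=
    measurableSet_le measurable_const measurable_norm
  rw [← h2, ← lintegral_indicator hms]
  refine lintegral_mono fun x => ?_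
  by_cases h : x ∈ {x : EuclideanSpace ℝ (Fin N) | σ ≤ ‖x‖}
  · have h' : ‖x‖ ∈ Ici σ := h
    simp only [indicator_of_mem h, hfdef, indicator_of_mem h']
    exact ENNReal.ofReal_le_ofReal (le_abs_self _)
  · simp [indicator_of_notMem h]

end Powers

/-! ### Integrability of the kernel -/

section Integrability

variable {N : ℕ} {A B : ℝ} {K : EuclideanSpace ℝ (Fin N) → ℝ}

theorem IsKernel.measurable (hK : IsKernel A B K) : Measurable K :=
  measurable_of_continuousOn_compl_singleton 0 hK.1.continuousOn

/-- A kernel is bounded by the sum of an integrable function and a constant. The constant has to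
include `|K 0|`, which is not controlled by `A`. -/
theorem IsKernel.exists_enorm_le (hN : 0 < N) (hA : 0 ≤ A) (hK : IsKernel A B K) :
    ∃ (κ : EuclideanSpace ℝ (Fin N) → ℝ≥0∞) (c : ℝ≥0), Measurable κ ∧ ∫⁻ x, κ x < ∞ ∧
      ∀ x, ‖K x‖ₑ ≤ κ x + c := by
  have hm : Measurable fun x : EuclideanSpace ℝ (Fin N) =>
      ENNReal.ofReal A * ENNReal.ofReal (1 / ‖x‖ ^ (N - 1)) := by fun_prop
  refine ⟨(closedBall 0 1).indicator fun x => ENNReal.ofReal A * ENNReal.ofReal (1 / ‖x‖ ^ (N - 1)),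
    A.toNNReal + ‖K 0‖₊, hm.indicator measurableSet_closedBall, ?_, fun x => ?_⟩
  · rw [lintegral_indicator measurableSet_closedBall, lintegral_const_mul _ (by fun_prop)]
    exact ENNReal.mul_lt_top ENNReal.ofReal_lt_top
      ((setLIntegral_closedBall_norm_pow_le hN zero_le_one).trans_lt (by simp))
  · rcases eq_or_ne x 0 with rfl | hx
    · push_cast
      exact le_add_left (le_add_left le_rfl)
    have h1 : ‖K x‖ₑ ≤ ENNReal.ofReal (A / ‖x‖ ^ (N - 1)) := by
      rw [← ofReal_norm]
      exact ENNReal.ofReal_le_ofReal (hK.2.1 x hx)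
    by_cases h : x ∈ closedBall (0 : EuclideanSpace ℝ (Fin N)) 1
    · rw [indicator_of_mem h, ← ENNReal.ofReal_mul hA, mul_one_div]
      exact h1.trans le_self_add
    · rw [indicator_of_notMem h, zero_add, ENNReal.coe_add]
      refine (h1.trans ?_).trans le_self_add
      have h2 : 1 ≤ ‖x‖ := by
        have : 1 < ‖x‖ := by simpa using h
        exact this.le
      exact ENNReal.ofReal_le_ofReal (div_le_self hA (one_le_pow₀ h2))

/-- The convolution of a kernel with a finite measure of bounded density converges everywhere. -/
theorem IsKernel.integrable_of_le_volume (hN : 0 < N) (hA : 0 ≤ A) (hK : IsKernel A B K)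
    {γ : Measure (EuclideanSpace ℝ (Fin N))} [IsFiniteMeasure γ] {c : ℝ≥0∞} (hc : c ≠ ∞)
    (hγ : γ ≤ c • volume) (x : EuclideanSpace ℝ (Fin N)) :
    Integrable (fun z => K (x - z)) γ := by
  obtain ⟨κ, b, hκ, hκi, hle⟩ := hK.exists_enorm_le hN hA
  refine ⟨(hK.measurable.comp (measurable_const.sub measurable_id)).aestronglyMeasurable, ?_⟩
  calc ∫⁻ z, ‖K (x - z)‖ₑ ∂γ ≤ ∫⁻ z, (κ (x - z) + b) ∂γ := lintegral_mono fun z => hle _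
    _ = (∫⁻ z, κ (x - z) ∂γ) + b * γ univ := by
        rw [lintegral_add_right _ measurable_const, lintegral_const]
    _ ≤ c * (∫⁻ z, κ z) + b * γ univ := by
        gcongr
        refine (lintegral_mono' hγ le_rfl).trans_eq ?_
        rw [lintegral_smul_measure, lintegral_sub_left_eq_self, smul_eq_mul]
    _ < ∞ := by
        refine ENNReal.add_lt_top.2 ⟨ENNReal.mul_lt_top hc.lt_top hκi,
          ENNReal.mul_lt_top ENNReal.coe_lt_top (measure_lt_top _ _)⟩

/-- The convolution of a kernel with a finite measure converges absolutely almost everywhere, by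
Tonelli's theorem. -/
theorem IsKernel.ae_lintegral_enorm_lt_top (hN : 0 < N) (hA : 0 ≤ A) (hK : IsKernel A B K)
    (μ : Measure (EuclideanSpace ℝ (Fin N))) [IsFiniteMeasure μ] :
    ∀ᵐ x, ∫⁻ z, ‖K (x - z)‖ₑ ∂μ < ∞ := by
  obtain ⟨κ, b, hκ, hκi, hle⟩ := hK.exists_enorm_le hN hA
  have hm : Measurable fun p : EuclideanSpace ℝ (Fin N) × EuclideanSpace ℝ (Fin N) =>
      κ (p.1 - p.2) := hκ.comp (measurable_fst.sub measurable_snd)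
  have h1 : ∫⁻ x, ∫⁻ z, κ (x - z) ∂μ ≠ ∞ := by
    rw [lintegral_lintegral_swap hm.aemeasurable]
    simp only [lintegral_sub_right_eq_self]
    rw [lintegral_const]
    exact (ENNReal.mul_lt_top hκi (measure_lt_top _ _)).ne
  filter_upwards [ae_lt_top hm.lintegral_prod_right' h1] with x hx
  calc ∫⁻ z, ‖K (x - z)‖ₑ ∂μ ≤ ∫⁻ z, (κ (x - z) + b) ∂μ := lintegral_mono fun z => hle _
    _ = (∫⁻ z, κ (x - z) ∂μ) + b * μ univ := by
        rw [lintegral_add_right _ measurable_const, lintegral_const]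
    _ < ∞ := ENNReal.add_lt_top.2 ⟨hx, ENNReal.mul_lt_top ENNReal.coe_lt_top (measure_lt_top _ _)⟩

end Integrability

/-! ### The error made by transporting the measure -/

section BadPart

variable {N : ℕ} {A B : ℝ} {K : EuclideanSpace ℝ (Fin N) → ℝ}

/-- The function `|z - w| / |x - z|^(N+1)` of `x` and `p = (z, w)`, set to `0` unless
`4 |z - w| ≤ |x - z|`. -/
noncomputable def transportWeight (x : EuclideanSpace ℝ (Fin N))
    (p : EuclideanSpace ℝ (Fin N) × EuclideanSpace ℝ (Fin N)) : ℝ≥0∞ :=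
  if 4 * ‖p.1 - p.2‖ ≤ ‖x - p.1‖ then ENNReal.ofReal (‖p.1 - p.2‖ / ‖x - p.1‖ ^ (N + 1)) else 0

/-- The integral of `transportWeight` against a transport plan. -/
noncomputable def transportCost (π : Measure (EuclideanSpace ℝ (Fin N) × EuclideanSpace ℝ (Fin N)))
    (x : EuclideanSpace ℝ (Fin N)) : ℝ≥0∞ :=
  ∫⁻ p, transportWeight x p ∂π

theorem measurable_transportWeight :
    Measurable (Function.uncurry (transportWeight (N := N))) :=
  Measurable.ite (measurableSet_le (by fun_prop) (by fun_prop)) (by fun_prop) measurable_const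

theorem measurable_transportCost
    (π : Measure (EuclideanSpace ℝ (Fin N) × EuclideanSpace ℝ (Fin N))) [SFinite π] :
    Measurable (transportCost π) :=
  measurable_transportWeight.lintegral_prod_right'

/-- By Tonelli's theorem it suffices to integrate `transportWeight` in `x`; the result is independent
of `|z - w|`, by scaling. -/
theorem lintegral_transportCost_le (hN : 0 < N)
    (π : Measure (EuclideanSpace ℝ (Fin N) × EuclideanSpace ℝ (Fin N))) [SFinite π] :
    ∫⁻ x, transportCost π x ≤ sphereArea N * π univ := by
  unfold transportCost
  rw [lintegral_lintegral_swap measurable_transportWeight.aemeasurable, ← lintegral_const]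
  refine lintegral_mono ?_
  rintro ⟨z, w⟩
  rcases eq_or_ne z w with rfl | hzw
  · simp [transportWeight]
  have ha : 0 < ‖z - w‖ := norm_pos_iff.2 (sub_ne_zero.2 hzw)
  calc ∫⁻ x, transportWeight x (z, w)
      = ∫⁻ x, {v : EuclideanSpace ℝ (Fin N) | 4 * ‖z - w‖ ≤ ‖v‖}.indicator
          (fun v => ENNReal.ofReal ‖z - w‖ * ENNReal.ofReal (1 / ‖v‖ ^ (N + 1))) (x - z) := by
        refine lintegral_congr fun x => ?_
        simp only [transportWeight, indicator_apply, mem_ofPred_eq]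
        rw [← ENNReal.ofReal_mul ha.le, mul_one_div]
    _ = ENNReal.ofReal ‖z - w‖ *
          ∫⁻ v in {v : EuclideanSpace ℝ (Fin N) | 4 * ‖z - w‖ ≤ ‖v‖},
            ENNReal.ofReal (1 / ‖v‖ ^ (N + 1)) := by
        rw [lintegral_sub_right_eq_self (fun v =>
          {v : EuclideanSpace ℝ (Fin N) | 4 * ‖z - w‖ ≤ ‖v‖}.indicator
          (fun v => ENNReal.ofReal ‖z - w‖ * ENNReal.ofReal (1 / ‖v‖ ^ (N + 1))) v) z,
          lintegral_indicator (measurableSet_le measurable_const measurable_norm),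
          lintegral_const_mul _ (by fun_prop)]
    _ ≤ ENNReal.ofReal ‖z - w‖ * (sphereArea N * ENNReal.ofReal (1 / (4 * ‖z - w‖))) := by
        gcongr
        exact setLIntegral_compl_norm_pow_le hN (by positivity)
    _ = sphereArea N * ENNReal.ofReal (1 / 4) := by
        rw [mul_left_comm, ← ENNReal.ofReal_mul ha.le]
        congr 2
        field_simp
    _ ≤ sphereArea N := by
        refine mul_le_of_le_one_right' ?_
        rw [ENNReal.ofReal_le_one]; norm_num

theorem IsKernel.enorm_integral_second_difference_le (hN : 0 < N) (hA : 0 ≤ A) (hB : 0 ≤ B)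
    (hK : IsKernel A B K) {π : Measure (EuclideanSpace ℝ (Fin N) × EuclideanSpace ℝ (Fin N))}
    [SFinite π] {x y : EuclideanSpace ℝ (Fin N)}
    (hx : ∀ᵐ p ∂π, 4 * ‖p.1 - p.2‖ ≤ ‖x - p.1‖) (hy : ∀ᵐ p ∂π, 4 * ‖p.1 - p.2‖ ≤ ‖y - p.1‖) :
    ‖∫ p, ((K (x - p.1) - K (x - p.2)) - (K (y - p.1) - K (y - p.2))) ∂π‖ₑ ≤
      ENNReal.ofReal (2 ^ (2 * N + 3) * (A + B)) * (transportCost π x + transportCost π y) *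
        ‖x - y‖ₑ := by
  refine (enorm_integral_le_lintegral_enorm _).trans ?_
  have hc : 0 ≤ 2 ^ (2 * N + 3) * (A + B) := by positivity
  have hm : Measurable (transportWeight x) :=
    measurable_transportWeight.of_uncurry_left
  unfold transportCost
  rw [← lintegral_add_left hm, ← lintegral_const_mul' _ _ ENNReal.ofReal_ne_top,
    ← lintegral_mul_const' _ _ enorm_ne_top]
  refine lintegral_mono_ae ?_
  filter_upwards [hx, hy] with p hpx hpy
  rw [transportWeight, transportWeight, if_pos hpx, if_pos hpy, ← ofReal_norm, ← ofReal_norm,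
    ← ENNReal.ofReal_add (by positivity) (by positivity), ← ENNReal.ofReal_mul hc,
    ← ENNReal.ofReal_mul (by positivity)]
  refine ENNReal.ofReal_le_ofReal ((hK.abs_second_difference_le hN hA hB hpx hpy).trans_eq ?_)
  ring

/-- Off a small set, replacing `μ` by a measure `γ` of bounded density changes the convolution by a
Lipschitz function. -/
theorem exists_bounded_density_replacement (hN : 0 < N) (hA : 0 ≤ A) (hB : 0 ≤ B)
    (μ : Measure (EuclideanSpace ℝ (Fin N))) [IsFiniteMeasure μ] :
    ∃ (G : Set (EuclideanSpace ℝ (Fin N))) (γ : Measure (EuclideanSpace ℝ (Fin N))),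
      MeasurableSet G ∧ volume G ≤ (ENNReal.ofReal (30 ^ N) + sphereArea N) * μ univ ∧
      γ univ = μ univ ∧ γ ≤ ENNReal.ofReal (5 ^ N + 1) • volume ∧
      ∀ K : EuclideanSpace ℝ (Fin N) → ℝ, IsKernel A B K → ∀ x ∉ G, ∀ y ∉ G,
        Integrable (fun z => K (x - z)) μ → Integrable (fun z => K (y - z)) μ →
        ‖((∫ z, K (x - z) ∂μ) - ∫ z, K (x - z) ∂γ) - ((∫ z, K (y - z) ∂μ) - ∫ z, K (y - z) ∂γ)‖ₑ ≤
          ENNReal.ofReal (2 ^ (2 * N + 4) * (A + B)) * ‖x - y‖ₑ := by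
  have : Nonempty (Fin N) := ⟨⟨0, hN⟩⟩
  obtain ⟨G, μ', π, hG, hGv, hμ, hγ, hsep⟩ := exists_transport_plan μ
  rw [finrank_euclideanSpace_fin] at hGv hγ
  have hle' : μ' ≤ μ := by rw [hμ]; exact Measure.le_add_right le_rfl
  have hlef : π.fst ≤ μ := by rw [hμ]; exact Measure.le_add_left le_rfl
  have : IsFiniteMeasure μ' := isFiniteMeasure_of_le μ hle'
  have hπu : π univ ≤ μ univ := by rw [← Measure.fst_univ]; exact hlef _
  have : IsFiniteMeasure π := ⟨hπu.trans_lt (measure_lt_top _ _)⟩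
  set γ := μ' + π.snd with hγdef
  have hγu : γ univ = μ univ := by
    rw [hγdef, hμ, Measure.add_apply, Measure.add_apply, Measure.snd_univ, Measure.fst_univ]
  have hγ_int : ∀ K : EuclideanSpace ℝ (Fin N) → ℝ, IsKernel A B K → ∀ x,
      Integrable (fun z => K (x - z)) γ :=
    fun K hK x => hK.integrable_of_le_volume hN hA ENNReal.ofReal_ne_top hγ x
  refine ⟨G ∪ {x | 1 ≤ transportCost π x}, γ,
    hG.union (measurableSet_le measurable_const (measurable_transportCost π)), ?_, hγu, hγ, ?_⟩
  · refine (measure_union_le _ _).trans ?_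
    rw [add_mul]
    refine add_le_add hGv ?_
    have h1 := mul_meas_ge_le_lintegral (μ := volume) (measurable_transportCost π) 1
    rw [one_mul] at h1
    refine h1.trans ((lintegral_transportCost_le hN π).trans ?_)
    gcongr
  · intro K hK x hx y hy hxi hyi
    have key : ∀ x, Integrable (fun z => K (x - z)) μ →
        Integrable (fun p : EuclideanSpace ℝ (Fin N) × EuclideanSpace ℝ (Fin N) =>
          K (x - p.1) - K (x - p.2)) π ∧
        (∫ z, K (x - z) ∂μ) - ∫ z, K (x - z) ∂γ = ∫ p, (K (x - p.1) - K (x - p.2)) ∂π := by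
      intro x hxi
      have hγi := hγ_int K hK x
      have i1 : Integrable (fun z => K (x - z)) μ' := hxi.mono_measure hle'
      have i2 : Integrable (fun z => K (x - z)) π.fst := hxi.mono_measure hlef
      have i3 : Integrable (fun z => K (x - z)) π.snd :=
        hγi.mono_measure (Measure.le_add_left le_rfl)
      have i4 : Integrable (fun p : EuclideanSpace ℝ (Fin N) × EuclideanSpace ℝ (Fin N) =>
          K (x - p.1)) π := i2.comp_measurable measurable_fst
      have i5 : Integrable (fun p : EuclideanSpace ℝ (Fin N) × EuclideanSpace ℝ (Fin N) =>
          K (x - p.2)) π := i3.comp_measurable measurable_snd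
      refine ⟨i4.sub i5, ?_⟩
      rw [integral_sub i4 i5]
      conv_lhs => rw [hμ, hγdef]
      rw [integral_add_measure i1 i2, integral_add_measure i1 i3, Measure.fst, Measure.snd,
        integral_map measurable_fst.aemeasurable i2.1, integral_map measurable_snd.aemeasurable i3.1]
      ring
    rw [(key x hxi).2, (key y hyi).2, ← integral_sub (key x hxi).1 (key y hyi).1]
    simp only [mem_union, not_or, mem_ofPred_eq, not_le] at hx hy
    refine (hK.enorm_integral_second_difference_le hN hA hB (hsep x hx.1) (hsep y hy.1)).trans ?_
    gcongr
    calc _ ≤ ENNReal.ofReal (2 ^ (2 * N + 3) * (A + B)) * (1 + 1) := by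
          gcongr
          · exact hx.2.le
          · exact hy.2.le
      _ = ENNReal.ofReal (2 ^ (2 * N + 4) * (A + B)) := by
          rw [one_add_one_eq_two, ← ENNReal.ofReal_ofNat, ← ENNReal.ofReal_mul (by positivity)]
          congr 1
          ring

end BadPart

/-! ### Plancherel's theorem and convolution -/

section Fourier

open FourierTransform Real
open scoped ContDiff Convolution InnerProductSpace

variable {E : Type*} [NormedAddCommGroup E] [InnerProductSpace ℝ E] [FiniteDimensional ℝ E]
  [MeasurableSpace E] [BorelSpace E]

/-- On `L¹ ∩ L²` the Fourier transform of `L²` is the Fourier integral: both have the same integrals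
against test functions. -/
theorem fourier_toLp_ae_eq {f : E → ℂ} (h1 : Integrable f) (h2 : MemLp f 2) :
    ((𝓕 (h2.toLp f) : Lp ℂ 2 (volume : Measure E)) : E → ℂ) =ᵐ[volume] 𝓕 f := by
  have hcont : Continuous (𝓕 f) :=
    VectorFourier.fourierIntegral_continuous continuous_fourierChar continuous_inner h1
  refine ae_eq_of_integral_contDiff_smul_eq ((Lp.memLp _).locallyIntegrable one_le_two)
    hcont.locallyIntegrable fun g hg hgc => ?_
  have hg₁ : HasCompactSupport (Complex.ofRealCLM ∘ g) := hgc.comp_left rfl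
  have hg₂ : ContDiff ℝ ∞ (Complex.ofRealCLM ∘ g) := by fun_prop
  set G := hg₁.toSchwartzMap hg₂ with hG
  have hGapp : ∀ x, G x = (g x : ℂ) := fun x => rfl
  have e1 := congrArg (fun T => T G) (Lp.fourier_toTemperedDistribution_eq (h2.toLp f))
  simp only [TemperedDistribution.fourier_apply, Lp.toTemperedDistribution_apply] at e1
  have e2 : ∫ x, g x • (𝓕 (h2.toLp f) : Lp ℂ 2 (volume : Measure E)) x =
      ∫ x, G x • (𝓕 (h2.toLp f) : Lp ℂ 2 (volume : Measure E)) x := by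
    refine integral_congr_ae (.of_forall fun x => ?_)
    simp [hGapp]
  rw [e2, ← e1]
  have e3 : ∫ x, (𝓕 G) x • (h2.toLp f) x = ∫ x, (𝓕 G) x • f x := by
    refine integral_congr_ae ?_
    filter_upwards [h2.coeFn_toLp] with x hx
    rw [hx]
  have e4 := VectorFourier.integral_fourierIntegral_smul_eq_flip (𝕜 := ℝ) (L := innerₗ E)
    (f := (G : E → ℂ)) (g := f) (μ := volume) (ν := volume) continuous_fourierChar
    continuous_inner G.integrable h1
  rw [e3]
  simp only [flip_innerₗ] at e4
  refine Eq.trans ?_ (e4.trans ?_)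
  · rfl
  · refine integral_congr_ae (.of_forall fun x => ?_)
    simp only [hGapp]
    rw [Complex.real_smul, smul_eq_mul]
    rfl

/-- Plancherel's theorem for the Fourier integral of a function in `L¹ ∩ L²`. -/
theorem lintegral_enorm_fourier_sq {f : E → ℂ} (h1 : Integrable f) (h2 : MemLp f 2) :
    ∫⁻ ξ, ‖𝓕 f ξ‖ₑ ^ 2 = ∫⁻ x, ‖f x‖ₑ ^ 2 := by
  have key : ∀ h : Lp ℂ 2 (volume : Measure E), ∫⁻ x, ‖h x‖ₑ ^ 2 = ‖h‖ₑ ^ 2 := by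
    intro h
    rw [Lp.enorm_def, eLpNorm_eq_lintegral_rpow_enorm_toReal two_ne_zero ENNReal.ofNat_ne_top,
      ← ENNReal.rpow_natCast, ← ENNReal.rpow_mul]
    simp
  have e1 : ∫⁻ ξ, ‖𝓕 f ξ‖ₑ ^ 2 = ∫⁻ ξ, ‖(𝓕 (h2.toLp f) : Lp ℂ 2 (volume : Measure E)) ξ‖ₑ ^ 2 := by
    refine lintegral_congr_ae ?_
    filter_upwards [fourier_toLp_ae_eq h1 h2] with x hx
    rw [hx]
  have e2 : ∫⁻ x, ‖f x‖ₑ ^ 2 = ∫⁻ x, ‖h2.toLp f x‖ₑ ^ 2 := by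
    refine lintegral_congr_ae ?_
    filter_upwards [h2.coeFn_toLp] with x hx
    rw [hx]
  rw [e1, e2, key, key, ← ofReal_norm, ← ofReal_norm, Lp.norm_fourier_eq]

theorem memLp_two_of_integrable_of_bounded {F : Type*} [NormedAddCommGroup F] {f : E → F} {c : ℝ}
    (hf : Integrable f) (hc : ∀ x, ‖f x‖ ≤ c) : MemLp f 2 := by
  rw [memLp_two_iff_integrable_sq_norm hf.1]
  simp only [sq]
  exact hf.norm.bdd_mul hf.norm.1 (.of_forall fun x => by rw [norm_norm]; exact hc x)

theorem enorm_sq_le_sum_basis {F : Type*} [NormedAddCommGroup F] [InnerProductSpace ℝ F]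
    [FiniteDimensional ℝ F] (L : F →L[ℝ] ℝ) :
    ‖L‖ₑ ^ 2 ≤ ∑ i, ‖L (stdOrthonormalBasis ℝ F i)‖ₑ ^ 2 := by
  set v := (InnerProductSpace.toDual ℝ F).symm L with hv
  have h1 : ‖L‖ = ‖v‖ := by rw [hv, LinearIsometryEquiv.norm_map]
  have h2 : ∀ w, L w = ⟪v, w⟫_ℝ := fun w => by
    rw [hv, InnerProductSpace.toDual_symm_apply]
  have h3 := (stdOrthonormalBasis ℝ F).sum_sq_norm_inner_left v
  rw [← ofReal_norm, h1, ← ENNReal.ofReal_pow (norm_nonneg _), ← h3,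
    ENNReal.ofReal_sum_of_nonneg fun i _ => by positivity]
  refine Finset.sum_le_sum fun i _ => ?_
  rw [ENNReal.ofReal_pow (norm_nonneg _), ofReal_norm, h2]

theorem fourier_fderiv_apply {J : E → ℝ} (hJ : ContDiff ℝ 1 J) (hJc : HasCompactSupport J)
    (v ξ : E) :
    𝓕 (fun x => ((fderiv ℝ J x v : ℝ) : ℂ)) ξ =
      (2 * π * Complex.I * ⟪ξ, v⟫_ℝ) * 𝓕 (fun x => (J x : ℂ)) ξ := by
  have hd : ∀ x, HasFDerivAt (fun x => (J x : ℂ)) (Complex.ofRealCLM.comp (fderiv ℝ J x)) x :=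
    fun x => Complex.ofRealCLM.hasFDerivAt.comp x ((hJ.differentiable one_ne_zero x).hasFDerivAt)
  have hfd : fderiv ℝ (fun x => (J x : ℂ)) = fun x => Complex.ofRealCLM.comp (fderiv ℝ J x) :=
    funext fun x => (hd x).fderiv
  have hint : Integrable (fun x => (J x : ℂ)) :=
    (hJ.continuous.integrable_of_hasCompactSupport hJc).ofReal
  have hint' : Integrable (fderiv ℝ (fun x => (J x : ℂ))) := by
    rw [hfd]
    have := (hJ.continuous_fderiv one_ne_zero).integrable_of_hasCompactSupport (μ := volume)
      (hJc.fderiv ℝ)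
    exact (ContinuousLinearMap.compL ℝ E ℝ ℂ Complex.ofRealCLM).integrable_comp this
  have h1 := Real.fourier_fderiv hint (fun x => (hd x).differentiableAt) hint'
  have h2 := congrArg (fun T => T ξ v) h1
  rw [Real.fourier_continuousLinearMap_apply hint'] at h2
  rw [hfd] at h2
  simp only [ContinuousLinearMap.comp_apply, Complex.ofRealCLM_apply,
    VectorFourier.fourierSMulRight_apply] at h2
  change _ = -(2 * π * Complex.I) • (-⟪ξ, v⟫_ℝ) • 𝓕 (fun x => (J x : ℂ)) ξ at h2
  rw [h2, smul_eq_mul, Complex.real_smul, Complex.ofReal_neg]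
  ring

/-- The convolution of a compactly supported `C¹` function with an integrable function is `C¹`. -/
theorem contDiff_integral_sub_mul {J g : E → ℝ} (hJ : ContDiff ℝ 1 J) (hJc : HasCompactSupport J)
    (hg : Integrable g) : ContDiff ℝ 1 (fun x => ∫ z, J (x - z) * g z) := by
  have h1 : (fun x => ∫ z, J (x - z) * g z) = g ⋆[ContinuousLinearMap.mul ℝ ℝ] J := by
    ext x; simp [convolution_def, mul_comm]
  rw [h1]
  exact hJc.contDiff_convolution_right _ hg.locallyIntegrable hJ

theorem fderiv_integral_sub_mul {J g : E → ℝ} (hJ : ContDiff ℝ 1 J) (hJc : HasCompactSupport J)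
    (hg : Integrable g) (x v : E) :
    fderiv ℝ (fun x => ∫ z, J (x - z) * g z) x v = ∫ z, fderiv ℝ J (x - z) v * g z := by
  have h1 : (fun x => ∫ z, J (x - z) * g z) = g ⋆[ContinuousLinearMap.mul ℝ ℝ] J := by
    ext x; simp [convolution_def, mul_comm]
  rw [h1, (hJc.hasFDerivAt_convolution_right _ hg.locallyIntegrable hJ x).fderiv,
    convolution_precompR_apply _ hg.locallyIntegrable (hJc.fderiv ℝ)
      (hJ.continuous_fderiv one_ne_zero)]
  simp [convolution_def, mul_comm]

/-- The `L²` norm of the gradient of a convolution, expressed by Fourier transforms. -/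
theorem lintegral_fderiv_convolution_sq_le {J g : E → ℝ} (hJ : ContDiff ℝ 1 J)
    (hJc : HasCompactSupport J) (hg : Integrable g) :
    ∫⁻ x, ‖fderiv ℝ (fun x => ∫ z, J (x - z) * g z) x‖ₑ ^ 2 ≤
      finrank ℝ E * ∫⁻ ξ, ENNReal.ofReal (2 * π * ‖ξ‖ * ‖𝓕 (fun x => (J x : ℂ)) ξ‖) ^ 2 *
        ‖𝓕 (fun x => (g x : ℂ)) ξ‖ₑ ^ 2 := by
  have hdc := hJ.continuous_fderiv one_ne_zero
  have hcu := (contDiff_integral_sub_mul hJ hJc hg).continuous_fderiv one_ne_zero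
  set u : E → ℝ := fun x => ∫ z, J (x - z) * g z with hu
  have key : ∀ v : E, ‖v‖ = 1 → ∫⁻ x, ‖fderiv ℝ u x v‖ₑ ^ 2 ≤
      ∫⁻ ξ, ENNReal.ofReal (2 * π * ‖ξ‖ * ‖𝓕 (fun x => (J x : ℂ)) ξ‖) ^ 2 *
        ‖𝓕 (fun x => (g x : ℂ)) ξ‖ₑ ^ 2 := by
    intro v hv
    have hJv : Continuous fun x => fderiv ℝ J x v := by fun_prop
    have hJvc : HasCompactSupport fun x => fderiv ℝ J x v := hJc.fderiv_apply ℝ v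
    have hJvi : Integrable fun x => ((fderiv ℝ J x v : ℝ) : ℂ) :=
      (hJv.integrable_of_hasCompactSupport hJvc).ofReal
    have hconv : (fun x => ((fderiv ℝ u x v : ℝ) : ℂ)) =
        (fun x => (g x : ℂ)) ⋆[ContinuousLinearMap.mul ℂ ℂ]
          (fun x => ((fderiv ℝ J x v : ℝ) : ℂ)) := by
      ext x
      rw [hu, fderiv_integral_sub_mul hJ hJc hg, convolution_def, ← integral_complex_ofReal]
      refine integral_congr_ae (.of_forall fun z => ?_)
      simp [mul_comm]
    have hi : Integrable fun x => ((fderiv ℝ u x v : ℝ) : ℂ) := by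
      rw [hconv]
      exact hg.ofReal.integrable_convolution _ hJvi
    obtain ⟨c, hc⟩ := hJv.bounded_above_of_compact_support hJvc
    have hb : ∀ x, ‖((fderiv ℝ u x v : ℝ) : ℂ)‖ ≤ ∫ z, c * ‖g z‖ := by
      intro x
      rw [Complex.norm_real, hu, fderiv_integral_sub_mul hJ hJc hg]
      refine norm_integral_le_of_norm_le (hg.norm.const_mul c) (.of_forall fun z => ?_)
      rw [norm_mul]
      gcongr
      exact hc _
    have hP := lintegral_enorm_fourier_sq hi (memLp_two_of_integrable_of_bounded hi hb)
    have e1 : ∫⁻ x, ‖fderiv ℝ u x v‖ₑ ^ 2 = ∫⁻ x, ‖((fderiv ℝ u x v : ℝ) : ℂ)‖ₑ ^ 2 := by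
      refine lintegral_congr fun x => ?_
      rw [← ofReal_norm, ← ofReal_norm, Complex.norm_real]
    rw [e1, ← hP]
    refine lintegral_mono fun ξ => ?_
    have hF := Real.fourier_mul_convolution_eq (R := ℂ) (f₁ := fun x => (g x : ℂ))
      hg.ofReal hJvi ξ
    rw [hconv, hF, fourier_fderiv_apply hJ hJc,
      ← mul_pow]
    gcongr
    rw [mul_comm, enorm_mul]
    gcongr
    rw [← ofReal_norm]
    refine ENNReal.ofReal_le_ofReal ?_
    rw [norm_mul]
    gcongr
    rw [norm_mul, norm_mul, norm_mul, Complex.norm_I, Complex.norm_real, Complex.norm_real,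
      Complex.norm_ofNat, mul_one, Real.norm_of_nonneg pi_pos.le]
    gcongr
    refine (norm_inner_le_norm ξ v).trans_eq ?_
    rw [hv, mul_one]
  calc ∫⁻ x, ‖fderiv ℝ u x‖ₑ ^ 2
      ≤ ∫⁻ x, ∑ i, ‖fderiv ℝ u x (stdOrthonormalBasis ℝ E i)‖ₑ ^ 2 :=
        lintegral_mono fun x => enorm_sq_le_sum_basis _
    _ = ∑ i, ∫⁻ x, ‖fderiv ℝ u x (stdOrthonormalBasis ℝ E i)‖ₑ ^ 2 := by
        refine lintegral_finsetSum _ fun i _ => ?_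
        have : Continuous fun x => fderiv ℝ u x (stdOrthonormalBasis ℝ E i) := by fun_prop
        exact this.enorm.measurable.pow_const 2
    _ ≤ ∑ i : Fin (finrank ℝ E), _ :=
        Finset.sum_le_sum fun i _ => key _ ((stdOrthonormalBasis ℝ E).norm_eq_one i)
    _ = _ := by simp

/-- The Fourier transform decays quadratically, with a constant given by the second derivative. -/
theorem sq_norm_mul_norm_fourier_le {J : E → ℝ} (hJ : ContDiff ℝ 2 J) (hJc : HasCompactSupport J)
    (ξ : E) :
    (2 * π * ‖ξ‖) ^ 2 * ‖𝓕 (fun x => (J x : ℂ)) ξ‖ ≤ ∫ x, ‖iteratedFDeriv ℝ 2 J x‖ := by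
  rcases eq_or_ne ξ 0 with rfl | hξ
  · simp only [norm_zero, mul_zero, ne_eq, OfNat.ofNat_ne_zero, not_false_eq_true, zero_pow, zero_mul]
    exact integral_nonneg fun x => norm_nonneg _
  have hJC : ContDiff ℝ 2 (fun x => (J x : ℂ)) := Complex.ofRealCLM.contDiff.comp hJ
  have hJCc : HasCompactSupport (fun x => (J x : ℂ)) := hJc.comp_left (g := Complex.ofReal) rfl
  have hint : ∀ n : ℕ, (n : ℕ∞) ≤ 2 → Integrable (iteratedFDeriv ℝ n (fun x => (J x : ℂ))) := by
    intro n hn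
    exact (hJC.continuous_iteratedFDeriv (by exact_mod_cast hn)).integrable_of_hasCompactSupport
      (hJCc.iteratedFDeriv n)
  have h1 := Real.fourier_iteratedFDeriv (N := 2) hJC hint (n := 2) le_rfl
  have h2 := congrArg (fun T => T ξ (fun _ => ξ)) h1
  simp only [VectorFourier.fourierPowSMulRight_apply] at h2
  have h3 : ‖𝓕 (iteratedFDeriv ℝ 2 (fun x => (J x : ℂ))) ξ (fun _ => ξ)‖ ≤
      (∫ x, ‖iteratedFDeriv ℝ 2 J x‖) * ‖ξ‖ ^ 2 := by
    refine (ContinuousMultilinearMap.le_opNorm _ _).trans ?_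
    simp only [Finset.prod_const, Finset.card_univ, Fintype.card_fin]
    gcongr
    refine (VectorFourier.norm_fourierIntegral_le_integral_norm _ _ _ _ _).trans_eq ?_
    refine integral_congr_ae (.of_forall fun x => ?_)
    exact Complex.ofRealLI.norm_iteratedFDeriv_comp_left hJ.contDiffAt le_rfl
  change _ = (-(2 * π * Complex.I)) ^ 2 • (∏ _i : Fin 2, -⟪ξ, ξ⟫_ℝ) • 𝓕 (fun x => (J x : ℂ)) ξ at h2
  rw [h2] at h3
  have h4 : (2 * π * ‖ξ‖) ^ 2 * ‖𝓕 (fun x => (J x : ℂ)) ξ‖ * ‖ξ‖ ^ 2 ≤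
      (∫ x, ‖iteratedFDeriv ℝ 2 J x‖) * ‖ξ‖ ^ 2 := by
    refine le_trans (le_of_eq ?_) h3
    simp only [Finset.prod_const, Finset.card_univ, Fintype.card_fin, norm_smul, norm_pow, norm_neg,
      norm_mul, Complex.norm_I, Complex.norm_real, Complex.norm_ofNat, Real.norm_of_nonneg pi_pos.le]
    simp only [real_inner_self_eq_norm_sq, Real.norm_eq_abs, abs_pow, abs_norm]
    ring
  exact le_of_mul_le_mul_right h4 (by positivity)

end Fourier

/-! ### Smooth truncations of a kernel -/

section Truncation

open scoped FourierTransform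

variable {N : ℕ} {A B : ℝ} {K : EuclideanSpace ℝ (Fin N) → ℝ}

/-- A smooth function with values in `[0, 1]`, equal to `1` on the unit ball and vanishing outside
the ball of radius `2`. -/
noncomputable def unitBump (N : ℕ) : ContDiffBump (0 : EuclideanSpace ℝ (Fin N)) :=
  ⟨1, 2, one_pos, one_lt_two⟩

/-- The rescaled bump function, equal to `1` on the ball of radius `r` and vanishing outside the
ball of radius `2 r`. -/
noncomputable def cutoff (r : ℝ) (x : EuclideanSpace ℝ (Fin N)) : ℝ := unitBump N (r⁻¹ • x)

theorem contDiff_unitBump : ContDiff ℝ 2 (unitBump N) := by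
  exact_mod_cast (unitBump N).contDiff (n := 2)

theorem contDiff_cutoff (r : ℝ) : ContDiff ℝ 2 (cutoff (N := N) r) :=
  contDiff_unitBump.comp (contDiff_const_smul _)

theorem cutoff_mem_Icc (r : ℝ) (x : EuclideanSpace ℝ (Fin N)) : cutoff r x ∈ Icc (0 : ℝ) 1 :=
  ⟨(unitBump N).nonneg, (unitBump N).le_one⟩

theorem cutoff_eq_one {r : ℝ} (hr : 0 < r) {x : EuclideanSpace ℝ (Fin N)} (hx : ‖x‖ ≤ r) :
    cutoff r x = 1 := by
  refine (unitBump N).one_of_mem_closedBall ?_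
  rw [mem_closedBall_zero_iff, norm_smul, norm_inv, Real.norm_of_nonneg hr.le, inv_mul_le_iff₀ hr]
  simpa [unitBump] using hx

theorem cutoff_eq_zero {r : ℝ} (hr : 0 < r) {x : EuclideanSpace ℝ (Fin N)} (hx : 2 * r ≤ ‖x‖) :
    cutoff r x = 0 := by
  refine (unitBump N).zero_of_le_dist ?_
  rw [dist_zero_right, norm_smul, norm_inv, Real.norm_of_nonneg hr.le, le_inv_mul_iff₀ hr]
  simpa [unitBump, mul_comm] using hx

/-- The derivatives of the cutoff functions scale like powers of the norm. -/
theorem exists_norm_iteratedFDeriv_cutoff_le (N : ℕ) :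
    ∃ M : ℝ, ∀ r : ℝ, 0 < r → ∀ i ≤ 2, ∀ x : EuclideanSpace ℝ (Fin N),
      ‖x‖ ^ i * ‖iteratedFDeriv ℝ i (cutoff r) x‖ ≤ M := by
  have h1 : ∀ i : ℕ, ∃ M : ℝ, i ≤ 2 → ∀ x : EuclideanSpace ℝ (Fin N),
      ‖x‖ ^ i * ‖iteratedFDeriv ℝ i (unitBump N) x‖ ≤ M := by
    intro i
    by_cases hi : i ≤ 2
    · have h2 : Continuous (iteratedFDeriv ℝ i (unitBump N)) :=
        contDiff_unitBump.continuous_iteratedFDeriv (by exact_mod_cast hi)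
      have hc : Continuous fun x => ‖x‖ ^ i * ‖iteratedFDeriv ℝ i (unitBump N) x‖ :=
        (continuous_norm.pow i).mul h2.norm
      have hs : HasCompactSupport fun x => ‖x‖ ^ i * ‖iteratedFDeriv ℝ i (unitBump N) x‖ :=
        ((unitBump N).hasCompactSupport.iteratedFDeriv i).norm.mul_left
      obtain ⟨M, hM⟩ := hc.bounded_above_of_compact_support hs
      exact ⟨M, fun _ x => (le_abs_self _).trans (hM x)⟩
    · exact ⟨0, fun h => absurd h hi⟩
  choose M hM using h1
  refine ⟨max (M 0) (max (M 1) (M 2)), fun r hr i hi x => ?_⟩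
  have h2 : ‖x‖ ^ i * ‖iteratedFDeriv ℝ i (cutoff r) x‖ ≤ M i := by
    refine le_trans ?_ (hM i hi (r⁻¹ • x))
    let L : EuclideanSpace ℝ (Fin N) →L[ℝ] EuclideanSpace ℝ (Fin N) :=
      r⁻¹ • ContinuousLinearMap.id ℝ _
    have hL : ‖L‖ ≤ r⁻¹ := by
      rw [norm_smul, norm_inv, Real.norm_of_nonneg hr.le]
      exact mul_le_of_le_one_right (by positivity) ContinuousLinearMap.norm_id_le
    have h3 : ‖iteratedFDeriv ℝ i (cutoff r) x‖ ≤
        ‖iteratedFDeriv ℝ i (unitBump N) (r⁻¹ • x)‖ * (r⁻¹) ^ i := by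
      have h4 : iteratedFDeriv ℝ i (cutoff r) x = _ :=
        L.iteratedFDeriv_comp_right contDiff_unitBump x (i := i) (by exact_mod_cast hi)
      rw [h4]
      refine (ContinuousMultilinearMap.norm_compContinuousLinearMap_le _ _).trans ?_
      rw [Finset.prod_const, Finset.card_univ, Fintype.card_fin]
      exact mul_le_mul_of_nonneg_left (pow_le_pow_left₀ (norm_nonneg _) hL _) (norm_nonneg _)
    calc _ ≤ ‖x‖ ^ i * (‖iteratedFDeriv ℝ i (unitBump N) (r⁻¹ • x)‖ * (r⁻¹) ^ i) := by gcongr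
      _ = _ := by
        rw [norm_smul, mul_pow, norm_inv, Real.norm_of_nonneg hr.le]; ring
  refine h2.trans ?_
  interval_cases i <;> simp

/-- Cutting off a kernel gives a kernel, with constants independent of the scale `r`: by the product
rule, using the bound on `DK`. -/
theorem IsKernel.mul_cutoff (hN : 0 < N) (hA : 0 ≤ A) (hB : 0 ≤ B) (hK : IsKernel A B K) {M : ℝ}
    {r : ℝ} (hM : ∀ i ≤ 2, ∀ x : EuclideanSpace ℝ (Fin N),
      ‖x‖ ^ i * ‖iteratedFDeriv ℝ i (cutoff r) x‖ ≤ M) :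
    IsKernel A (M * (A + 2 ^ (N + 2) * (A + B) + B)) fun x => K x * cutoff r x := by
  have hc2 : ContDiff ℝ 2 (cutoff (N := N) r) := contDiff_cutoff r
  refine ⟨hK.1.mul hc2.contDiffOn, fun x hx => ?_, fun x hx => ?_⟩
  · rw [abs_mul, abs_of_nonneg (cutoff_mem_Icc r x).1]
    exact (mul_le_of_le_one_right (abs_nonneg _) (cutoff_mem_Icc r x).2).trans (hK.2.1 x hx)
  · have hxp : 0 < ‖x‖ := norm_pos_iff.2 hx
    have ho : IsOpen ({0}ᶜ : Set (EuclideanSpace ℝ (Fin N))) := isOpen_compl_singleton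
    have h := norm_iteratedFDerivWithin_mul_le hK.1 hc2.contDiffOn ho.uniqueDiffOn
      (x := x) (n := 2) hx le_rfl
    have e : ∀ (n : ℕ) (f : EuclideanSpace ℝ (Fin N) → ℝ),
        iteratedFDerivWithin ℝ n f {0}ᶜ x = iteratedFDeriv ℝ n f x :=
      fun n f => iteratedFDerivWithin_of_isOpen n ho hx
    simp only [e, Finset.sum_range_succ, Finset.sum_range_zero, zero_add, Nat.choose_zero_right,
      Nat.cast_one, one_mul, Nat.choose_one_right, Nat.choose_self, Nat.add_one_sub_one,
      norm_iteratedFDeriv_zero, norm_iteratedFDeriv_one, Nat.cast_ofNat] at h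
    change _ ≤ ‖K x‖ * ‖iteratedFDeriv ℝ 2 (cutoff r) x‖ +
      2 * ‖fderiv ℝ K x‖ * ‖fderiv ℝ (cutoff r) x‖ +
      ‖iteratedFDeriv ℝ 2 K x‖ * ‖iteratedFDeriv ℝ 0 (cutoff r) x‖ at h
    rw [norm_iteratedFDeriv_zero] at h
    refine h.trans ?_
    have m0 := hM 0 (by norm_num) x
    have m1 := hM 1 (by norm_num) x
    have m2 := hM 2 le_rfl x
    rw [pow_zero, one_mul, norm_iteratedFDeriv_zero] at m0
    rw [pow_one, norm_iteratedFDeriv_one, mul_comm, ← le_div_iff₀ hxp] at m1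
    rw [mul_comm, ← le_div_iff₀ (by positivity)] at m2
    have k0 : ‖K x‖ ≤ A / ‖x‖ ^ (N - 1) := hK.2.1 x hx
    have k1 := hK.norm_fderiv_le hN hA hB hx
    have k2 := hK.2.2 x hx
    have hM0 : 0 ≤ M := (norm_nonneg _).trans m0
    calc _ ≤ A / ‖x‖ ^ (N - 1) * (M / ‖x‖ ^ 2) +
          2 * (2 ^ (N + 1) * (A + B) / ‖x‖ ^ N) * (M / ‖x‖) + B / ‖x‖ ^ (N + 1) * M := by gcongr
      _ = _ := by
          obtain ⟨n, rfl⟩ : ∃ n, N = n + 1 := ⟨N - 1, by omega⟩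
          rw [Nat.add_sub_cancel]
          field_simp
          ring

theorem IsKernel.sub {A' B' : ℝ} {K' : EuclideanSpace ℝ (Fin N) → ℝ} (hK : IsKernel A B K)
    (hK' : IsKernel A' B' K') : IsKernel (A + A') (B + B') fun x => K x - K' x := by
  refine ⟨hK.1.sub hK'.1, fun x hx => ?_, fun x hx => ?_⟩
  · rw [add_div]
    exact (abs_sub _ _).trans (add_le_add (hK.2.1 x hx) (hK'.2.1 x hx))
  · rw [add_div]
    have h := iteratedFDeriv_sub_apply (i := 2) (hK.contDiffAt hx) (hK'.contDiffAt hx)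
    change ‖iteratedFDeriv ℝ 2 (K - K') x‖ ≤ _
    rw [h]
    exact (norm_sub_le _ _).trans (add_le_add (hK.2.2 x hx) (hK'.2.2 x hx))

/-- The part of the kernel that lives in the annulus `r ≤ |x| ≤ 2 R`. -/
noncomputable def annulus (K : EuclideanSpace ℝ (Fin N) → ℝ) (r R : ℝ)
    (x : EuclideanSpace ℝ (Fin N)) : ℝ :=
  K x * cutoff R x - K x * cutoff r x

theorem annulus_eq_zero_of_le {r R : ℝ} (hr : 0 < r) (hrR : r ≤ R)
    {x : EuclideanSpace ℝ (Fin N)} (hx : ‖x‖ ≤ r) : annulus K r R x = 0 := by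
  rw [annulus, cutoff_eq_one hr hx, cutoff_eq_one (hr.trans_le hrR) (hx.trans hrR), sub_self]

theorem annulus_eq_zero_of_ge {r R : ℝ} (hr : 0 < r) (hrR : r ≤ R)
    {x : EuclideanSpace ℝ (Fin N)} (hx : 2 * R ≤ ‖x‖) : annulus K r R x = 0 := by
  rw [annulus, cutoff_eq_zero (hr.trans_le hrR) hx, cutoff_eq_zero hr (by linarith), sub_self]

theorem abs_annulus_le (r R : ℝ) (x : EuclideanSpace ℝ (Fin N)) :
    |annulus K r R x| ≤ |K x| := by
  rw [annulus, ← mul_sub, abs_mul]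
  refine mul_le_of_le_one_right (abs_nonneg _) (abs_le.2 ?_)
  have h1 := cutoff_mem_Icc r x
  have h2 := cutoff_mem_Icc R x
  constructor <;> linarith [h1.1, h1.2, h2.1, h2.2]

theorem hasCompactSupport_annulus {r R : ℝ} (hr : 0 < r) (hrR : r ≤ R) :
    HasCompactSupport (annulus K r R) := by
  refine HasCompactSupport.intro (isCompact_closedBall 0 (2 * R)) fun x hx => ?_
  refine annulus_eq_zero_of_ge hr hrR ?_
  rw [mem_closedBall_zero_iff, not_le] at hx
  exact hx.le

theorem IsKernel.contDiff_annulus (hK : IsKernel A B K) {r R : ℝ} (hr : 0 < r) (hrR : r ≤ R) :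
    ContDiff ℝ 2 (annulus K r R) := by
  refine contDiff_iff_contDiffAt.2 fun x => ?_
  rcases eq_or_ne x 0 with rfl | hx
  · have : annulus K r R =ᶠ[𝓝 0] fun _ => 0 := by
      filter_upwards [closedBall_mem_nhds (0 : EuclideanSpace ℝ (Fin N)) hr] with y hy
      exact annulus_eq_zero_of_le hr hrR (mem_closedBall_zero_iff.1 hy)
    exact contDiffAt_const.congr_of_eventuallyEq this
  · have hc : ∀ r, ContDiffAt ℝ 2 (cutoff (N := N) r) x := fun r =>
      (contDiff_cutoff r).contDiffAt
    exact ((hK.contDiffAt hx).mul (hc R)).sub ((hK.contDiffAt hx).mul (hc r))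

theorem annulus_add_annulus (r s t : ℝ) (x : EuclideanSpace ℝ (Fin N)) :
    annulus K r s x + annulus K s t x = annulus K r t x := by
  simp only [annulus]; ring

/-- The Fourier transform of a kernel supported in a small ball is small. -/
theorem norm_fourier_le_of_support (hN : 0 < N) (hA : 0 ≤ A)
    {J : EuclideanSpace ℝ (Fin N) → ℝ} (hJc : Continuous J)
    (hJ : ∀ x, x ≠ 0 → |J x| ≤ A / ‖x‖ ^ (N - 1)) (hJ0 : J 0 = 0) {ρ : ℝ} (hρ : 0 ≤ ρ)
    (hs : ∀ x, ρ ≤ ‖x‖ → J x = 0) (ξ : EuclideanSpace ℝ (Fin N)) :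
    ‖𝓕 (fun x => (J x : ℂ)) ξ‖ ≤ sphereArea N * A * ρ := by
  refine (VectorFourier.norm_fourierIntegral_le_integral_norm _ _ _ _ _).trans ?_
  simp only [Complex.norm_real]
  rw [integral_norm_eq_lintegral_enorm hJc.aestronglyMeasurable]
  refine ENNReal.toReal_le_of_le_ofReal (by positivity) ?_
  calc ∫⁻ x, ‖J x‖ₑ ≤ ∫⁻ x, (closedBall (0 : EuclideanSpace ℝ (Fin N)) ρ).indicator
        (fun x => ENNReal.ofReal A * ENNReal.ofReal (1 / ‖x‖ ^ (N - 1))) x := by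
        refine lintegral_mono fun x => ?_
        by_cases hx : x ∈ closedBall (0 : EuclideanSpace ℝ (Fin N)) ρ
        · rcases eq_or_ne x 0 with rfl | hx0
          · simp [hJ0]
          · rw [indicator_of_mem hx, ← ENNReal.ofReal_mul hA, mul_one_div, ← ofReal_norm]
            exact ENNReal.ofReal_le_ofReal (hJ x hx0)
        · rw [mem_closedBall_zero_iff, not_le] at hx
          simp [hs x hx.le]
    _ = ENNReal.ofReal A * ∫⁻ x in closedBall (0 : EuclideanSpace ℝ (Fin N)) ρ,
          ENNReal.ofReal (1 / ‖x‖ ^ (N - 1)) := by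
        rw [lintegral_indicator measurableSet_closedBall, lintegral_const_mul _ (by fun_prop)]
    _ ≤ ENNReal.ofReal A * (sphereArea N * ENNReal.ofReal ρ) := by
        gcongr
        exact setLIntegral_closedBall_norm_pow_le hN hρ
    _ = ENNReal.ofReal (sphereArea N * A * ρ) := by
        rw [ENNReal.ofReal_mul (by positivity), ENNReal.ofReal_mul (by positivity),
          ENNReal.ofReal_coe_nnreal]
        ring

/-- The Fourier transform of a kernel supported away from a large ball is small, except near the
origin. -/
theorem IsKernel.sq_norm_mul_norm_fourier_le_of_support (hN : 0 < N) (hB : 0 ≤ B)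
    {J : EuclideanSpace ℝ (Fin N) → ℝ} (hJ : IsKernel A B J) (hJ2 : ContDiff ℝ 2 J)
    (hJc : HasCompactSupport J) {σ : ℝ} (hσ : 0 < σ)
    (hs : ∀ x, ‖x‖ ≤ σ → J x = 0) (ξ : EuclideanSpace ℝ (Fin N)) :
    (2 * Real.pi * ‖ξ‖) ^ 2 * ‖𝓕 (fun x => (J x : ℂ)) ξ‖ ≤ sphereArea N * B / σ := by
  refine (sq_norm_mul_norm_fourier_le hJ2 hJc ξ).trans ?_
  rw [integral_norm_eq_lintegral_enorm
    (hJ2.continuous_iteratedFDeriv le_rfl).aestronglyMeasurable]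
  refine ENNReal.toReal_le_of_le_ofReal (by positivity) ?_
  have hms : MeasurableSet {x : EuclideanSpace ℝ (Fin N) | σ ≤ ‖x‖} :=
    measurableSet_le measurable_const measurable_norm
  calc ∫⁻ x, ‖iteratedFDeriv ℝ 2 J x‖ₑ ≤ ∫⁻ x, {x : EuclideanSpace ℝ (Fin N) | σ ≤ ‖x‖}.indicator
        (fun x => ENNReal.ofReal B * ENNReal.ofReal (1 / ‖x‖ ^ (N + 1))) x := by
        refine lintegral_mono fun x => ?_
        by_cases hx : σ ≤ ‖x‖
        · rw [indicator_of_mem (by exact hx), ← ENNReal.ofReal_mul hB, mul_one_div, ← ofReal_norm]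
          exact ENNReal.ofReal_le_ofReal (hJ.2.2 x (norm_pos_iff.1 (hσ.trans_le hx)))
        · rw [not_le] at hx
          have h0 : J =ᶠ[𝓝 x] fun _ => 0 := by
            filter_upwards [(isOpen_lt continuous_norm continuous_const).mem_nhds hx] with y hy
            exact hs y (le_of_lt hy)
          rw [(h0.iteratedFDeriv ℝ 2).eq_of_nhds, iteratedFDeriv_const_of_ne two_ne_zero]
          simp
    _ = ENNReal.ofReal B * ∫⁻ x in {x : EuclideanSpace ℝ (Fin N) | σ ≤ ‖x‖},
          ENNReal.ofReal (1 / ‖x‖ ^ (N + 1)) := by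
        rw [lintegral_indicator hms, lintegral_const_mul _ (by fun_prop)]
    _ ≤ ENNReal.ofReal B * (sphereArea N * ENNReal.ofReal (1 / σ)) := by
        gcongr
        exact setLIntegral_compl_norm_pow_le hN hσ
    _ = ENNReal.ofReal (sphereArea N * B / σ) := by
        rw [div_eq_mul_one_div (_ * _) σ, ENNReal.ofReal_mul (by positivity),
          ENNReal.ofReal_mul (by positivity), ENNReal.ofReal_coe_nnreal]
        ring

theorem fourier_annulus_add (hK : IsKernel A B K) {r s t : ℝ} (hr : 0 < r) (hrs : r ≤ s)
    (hst : s ≤ t) (ξ : EuclideanSpace ℝ (Fin N)) :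
    𝓕 (fun x => (annulus K r t x : ℂ)) ξ =
      𝓕 (fun x => (annulus K r s x : ℂ)) ξ + 𝓕 (fun x => (annulus K s t x : ℂ)) ξ := by
  have hi : ∀ r s : ℝ, 0 < r → r ≤ s → Integrable fun x => (annulus K r s x : ℂ) :=
    fun r s hr hrs => ((hK.contDiff_annulus hr hrs).continuous.integrable_of_hasCompactSupport
      (hasCompactSupport_annulus hr hrs)).ofReal
  have h1 : (fun x => (annulus K r t x : ℂ)) =
      (fun x => (annulus K r s x : ℂ)) + fun x => (annulus K s t x : ℂ) := by
    ext x
    rw [Pi.add_apply, ← annulus_add_annulus r s t, Complex.ofReal_add]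
  rw [h1]
  exact congrFun (VectorFourier.fourierIntegral_add Real.continuous_fourierChar continuous_inner
    (hi r s hr hrs) (hi s t (hr.trans_le hrs) hst)) ξ

/-- A kernel is the limit of compactly supported `C²` functions whose Fourier transforms, multiplied
by `|ξ|`, are bounded and form a Cauchy sequence at every `ξ ≠ 0`. The Fourier transform at `ξ` is
estimated by splitting the kernel at the scale `1 / |ξ|`: the inner part is bounded by its `L¹` norm
and the outer part by the `L¹` norm of its second derivative. -/
theorem exists_truncations (hN : 0 < N) (hA : 0 ≤ A) (hB : 0 ≤ B) :
    ∃ Λ : ℝ≥0, ∀ K : EuclideanSpace ℝ (Fin N) → ℝ, IsKernel A B K →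
      ∃ k : ℕ → EuclideanSpace ℝ (Fin N) → ℝ, (∀ n, ContDiff ℝ 2 (k n)) ∧
        (∀ n, HasCompactSupport (k n)) ∧ (∀ n x, |k n x| ≤ |K x|) ∧
        (∀ x, x ≠ 0 → ∀ᶠ n in atTop, k n x = K x) ∧
        (∀ n ξ, 2 * Real.pi * ‖ξ‖ * ‖𝓕 (fun x => (k n x : ℂ)) ξ‖ ≤ Λ) ∧
        ∀ n m, n ≤ m → ∀ ξ, ξ ≠ 0 →
          2 * Real.pi * ‖ξ‖ * ‖𝓕 (fun x => ((k m x - k n x : ℝ) : ℂ)) ξ‖ ≤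
            Λ * min 2 ((‖ξ‖ + ‖ξ‖⁻¹) / (n + 1)) := by
  obtain ⟨M, hM⟩ := exists_norm_iteratedFDeriv_cutoff_le N
  set B' := M * (A + 2 ^ (N + 2) * (A + B) + B) with hB'
  have hM0 : 0 ≤ M := (by positivity : (0 : ℝ) ≤ ‖(0 : EuclideanSpace ℝ (Fin N))‖ ^ 0 *
    ‖iteratedFDeriv ℝ 0 (cutoff 1) (0 : EuclideanSpace ℝ (Fin N))‖).trans
      (hM 1 one_pos 0 (by norm_num) 0)
  have hB'0 : 0 ≤ B' := by positivity
  have hπ := Real.pi_pos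
  have hπ3 := Real.pi_gt_three
  -- The bounds for inner and outer annuli.
  have hin : ∀ K : EuclideanSpace ℝ (Fin N) → ℝ, IsKernel A B K → ∀ r R : ℝ, 0 < r → r ≤ R →
      ∀ ξ, ‖𝓕 (fun x => (annulus K r R x : ℂ)) ξ‖ ≤ sphereArea N * A * (2 * R) := by
    intro K hK r R hr hrR ξ
    refine norm_fourier_le_of_support hN hA (hK.contDiff_annulus hr hrR).continuous
      (fun x hx => (abs_annulus_le r R x).trans (hK.2.1 x hx))
      (annulus_eq_zero_of_le hr hrR (by simpa using hr.le)) (by linarith)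
      (fun x hx => annulus_eq_zero_of_ge hr hrR hx) ξ
  have hout : ∀ K : EuclideanSpace ℝ (Fin N) → ℝ, IsKernel A B K → ∀ r R σ : ℝ, 0 < r → r ≤ R →
      0 < σ → σ ≤ r → ∀ ξ, (2 * Real.pi * ‖ξ‖) ^ 2 * ‖𝓕 (fun x => (annulus K r R x : ℂ)) ξ‖ ≤
        sphereArea N * (B' + B') / σ := by
    intro K hK r R σ hr hrR hσ hσr ξ
    have hker : IsKernel (A + A) (B' + B') (annulus K r R) :=
      (hK.mul_cutoff hN hA hB (hM R (hr.trans_le hrR))).sub (hK.mul_cutoff hN hA hB (hM r hr))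
    exact hker.sq_norm_mul_norm_fourier_le_of_support hN (by positivity)
      (hK.contDiff_annulus hr hrR) (hasCompactSupport_annulus hr hrR) hσ
      (fun x hx => annulus_eq_zero_of_le hr hrR (hx.trans hσr)) ξ
  set S : ℝ := (sphereArea N : ℝ) with hS
  have hS0 : 0 ≤ S := NNReal.coe_nonneg _
  set Λ : ℝ := S * (4 * Real.pi * A + 2 * B') with hΛ
  have hΛ0 : 0 ≤ Λ := by positivity
  have hin' : ∀ K : EuclideanSpace ℝ (Fin N) → ℝ, IsKernel A B K → ∀ r R : ℝ, 0 < r → r ≤ R →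
      ∀ ξ, 2 * Real.pi * ‖ξ‖ * ‖𝓕 (fun x => (annulus K r R x : ℂ)) ξ‖ ≤
        S * (4 * Real.pi * A) * (‖ξ‖ * R) := by
    intro K hK r R hr hrR ξ
    calc _ ≤ 2 * Real.pi * ‖ξ‖ * (S * A * (2 * R)) := by
          gcongr; exact hin K hK r R hr hrR ξ
      _ = _ := by ring
  have hout' : ∀ K : EuclideanSpace ℝ (Fin N) → ℝ, IsKernel A B K → ∀ r R σ : ℝ, 0 < r → r ≤ R →
      0 < σ → σ ≤ r → ∀ ξ, ξ ≠ 0 →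
      2 * Real.pi * ‖ξ‖ * ‖𝓕 (fun x => (annulus K r R x : ℂ)) ξ‖ ≤
        S * (2 * B') * (‖ξ‖⁻¹ / σ) := by
    intro K hK r R σ hr hrR hσ hσr ξ hξ
    have hξ' : 0 < ‖ξ‖ := norm_pos_iff.2 hξ
    have h1 : 0 < 2 * Real.pi * ‖ξ‖ := by positivity
    refine le_of_mul_le_mul_left ?_ h1
    calc _ = (2 * Real.pi * ‖ξ‖) ^ 2 * ‖𝓕 (fun x => (annulus K r R x : ℂ)) ξ‖ := by ring
      _ ≤ S * (B' + B') / σ := hout K hK r R σ hr hrR hσ hσr ξ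
      _ ≤ (2 * Real.pi) * (S * (B' + B') / σ) := by
          refine le_mul_of_one_le_left (by positivity) (by linarith)
      _ = _ := by field_simp; ring
  have hbd : ∀ K : EuclideanSpace ℝ (Fin N) → ℝ, IsKernel A B K → ∀ r R : ℝ, 0 < r → r ≤ R →
      ∀ ξ, 2 * Real.pi * ‖ξ‖ * ‖𝓕 (fun x => (annulus K r R x : ℂ)) ξ‖ ≤ Λ := by
    intro K hK r R hr hrR ξ
    rcases eq_or_ne ξ 0 with rfl | hξ
    · simpa using hΛ0
    have hξ' : 0 < ‖ξ‖ := norm_pos_iff.2 hξ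
    have hρ : 0 < ‖ξ‖⁻¹ := by positivity
    have e1 : ‖ξ‖ * ‖ξ‖⁻¹ = 1 := mul_inv_cancel₀ hξ'.ne'
    have e2 : ‖ξ‖⁻¹ / ‖ξ‖⁻¹ = 1 := div_self hρ.ne'
    rcases le_total ‖ξ‖⁻¹ r with h1 | h1
    · have := hout' K hK r R _ hr hrR hρ h1 ξ hξ
      rw [e2] at this
      refine this.trans ?_
      rw [hΛ, mul_one]
      gcongr
      have : 0 ≤ 4 * Real.pi * A := by positivity
      linarith
    rcases le_total R ‖ξ‖⁻¹ with h2 | h2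
    · refine (hin' K hK r R hr hrR ξ).trans ?_
      calc _ ≤ S * (4 * Real.pi * A) * (‖ξ‖ * ‖ξ‖⁻¹) := by gcongr
        _ ≤ _ := by
          rw [e1, hΛ, mul_one]
          gcongr
          linarith
    · rw [fourier_annulus_add hK hr h1 h2]
      calc _ ≤ 2 * Real.pi * ‖ξ‖ * (‖𝓕 (fun x => (annulus K r ‖ξ‖⁻¹ x : ℂ)) ξ‖ +
            ‖𝓕 (fun x => (annulus K ‖ξ‖⁻¹ R x : ℂ)) ξ‖) := by
            gcongr; exact norm_add_le _ _
        _ ≤ S * (4 * Real.pi * A) * (‖ξ‖ * ‖ξ‖⁻¹) + S * (2 * B') * (‖ξ‖⁻¹ / ‖ξ‖⁻¹) := by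
            rw [mul_add]
            exact add_le_add (hin' K hK _ _ hr h1 ξ) (hout' K hK _ _ _ hρ h2 hρ le_rfl ξ hξ)
        _ = Λ := by rw [e1, e2, hΛ]; ring
  refine ⟨⟨Λ, hΛ0⟩, fun K hK => ⟨fun n => annulus K ((n : ℝ) + 1)⁻¹ (n + 1), ?_⟩⟩
  have hp : ∀ n : ℕ, (0 : ℝ) < ((n : ℝ) + 1)⁻¹ := fun n => by positivity
  have hle : ∀ n m : ℕ, ((n : ℝ) + 1)⁻¹ ≤ (m : ℝ) + 1 := fun n m =>
    (inv_le_one_of_one_le₀ (by linarith [(Nat.cast_nonneg n : (0 : ℝ) ≤ n)])).trans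
      (by linarith [(Nat.cast_nonneg m : (0 : ℝ) ≤ m)])
  refine ⟨fun n => hK.contDiff_annulus (hp n) (hle n n),
    fun n => hasCompactSupport_annulus (hp n) (hle n n), fun n x => abs_annulus_le _ _ x, ?_,
    fun n ξ => hbd K hK _ _ (hp n) (hle n n) ξ, ?_⟩
  · intro x hx
    have hxp : 0 < ‖x‖ := norm_pos_iff.2 hx
    filter_upwards [eventually_ge_atTop ⌈‖x‖⌉₊, eventually_ge_atTop ⌈2 * ‖x‖⁻¹⌉₊] with n h1 h2
    have h1' : ‖x‖ ≤ n := Nat.ceil_le.1 h1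
    have h2' : 2 * ‖x‖⁻¹ ≤ n := Nat.ceil_le.1 h2
    have hn : (0 : ℝ) < (n : ℝ) + 1 := by positivity
    rw [annulus, cutoff_eq_one hn (by linarith), cutoff_eq_zero (hp n), mul_one, mul_zero, sub_zero]
    rw [← div_eq_mul_inv, div_le_iff₀ hn]
    rw [← div_eq_mul_inv, div_le_iff₀ hxp] at h2'
    linarith
  · intro n m hnm ξ hξ
    have hξ' : 0 < ‖ξ‖ := norm_pos_iff.2 hξ
    have hnm' : (n : ℝ) ≤ m := by exact_mod_cast hnm
    have hi1 : ((m : ℝ) + 1)⁻¹ ≤ ((n : ℝ) + 1)⁻¹ := by gcongr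
    have hi2 : (n : ℝ) + 1 ≤ m + 1 := by linarith
    have hn : (0 : ℝ) < (n : ℝ) + 1 := by positivity
    have hc : ∀ r s : ℝ, 0 < r → r ≤ s → Integrable fun x => (annulus K r s x : ℂ) :=
      fun r s hr hrs => ((hK.contDiff_annulus hr hrs).continuous.integrable_of_hasCompactSupport
        (hasCompactSupport_annulus hr hrs)).ofReal
    have e : 𝓕 (fun x => ((annulus K ((m : ℝ) + 1)⁻¹ (m + 1) x -
        annulus K ((n : ℝ) + 1)⁻¹ (n + 1) x : ℝ) : ℂ)) ξ =
        𝓕 (fun x => (annulus K ((m : ℝ) + 1)⁻¹ ((n : ℝ) + 1)⁻¹ x : ℂ)) ξ +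
          𝓕 (fun x => (annulus K ((n : ℝ) + 1) (m + 1) x : ℂ)) ξ := by
      have h1 : (fun x => ((annulus K ((m : ℝ) + 1)⁻¹ (m + 1) x -
          annulus K ((n : ℝ) + 1)⁻¹ (n + 1) x : ℝ) : ℂ)) =
          (fun x => (annulus K ((m : ℝ) + 1)⁻¹ ((n : ℝ) + 1)⁻¹ x : ℂ)) +
            fun x => (annulus K ((n : ℝ) + 1) (m + 1) x : ℂ) := by
        ext x
        rw [Pi.add_apply, ← Complex.ofReal_add]
        simp only [annulus]
        congr 1
        ring
      rw [h1]
      exact congrFun (VectorFourier.fourierIntegral_add Real.continuous_fourierChar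
        continuous_inner (hc _ _ (hp m) hi1) (hc _ _ hn hi2)) ξ
    rw [e]
    have h0 : 2 * Real.pi * ‖ξ‖ * ‖𝓕 (fun x => (annulus K ((m : ℝ) + 1)⁻¹ ((n : ℝ) + 1)⁻¹ x : ℂ)) ξ +
        𝓕 (fun x => (annulus K ((n : ℝ) + 1) (m + 1) x : ℂ)) ξ‖ ≤
        2 * Real.pi * ‖ξ‖ * ‖𝓕 (fun x => (annulus K ((m : ℝ) + 1)⁻¹ ((n : ℝ) + 1)⁻¹ x : ℂ)) ξ‖ +
        2 * Real.pi * ‖ξ‖ * ‖𝓕 (fun x => (annulus K ((n : ℝ) + 1) (m + 1) x : ℂ)) ξ‖ := by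
      rw [← mul_add]
      gcongr
      exact norm_add_le _ _
    refine h0.trans ?_
    change _ ≤ Λ * _
    rw [mul_min_of_nonneg _ _ hΛ0]
    refine le_min ?_ ?_
    · have e1 := hbd K hK _ _ (hp m) hi1 ξ
      have e2 := hbd K hK _ _ hn hi2 ξ
      linarith
    · have e1 := hin' K hK _ _ (hp m) hi1 ξ
      have e2 := hout' K hK _ _ _ hn hi2 hn le_rfl ξ hξ
      refine (add_le_add e1 e2).trans ?_
      rw [hΛ, add_div, ← div_eq_mul_inv]
      have f1 : 0 ≤ ‖ξ‖ / ((n : ℝ) + 1) := by positivity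
      have f2 : 0 ≤ ‖ξ‖⁻¹ / ((n : ℝ) + 1) := by positivity
      have g1 : 0 ≤ S * (4 * Real.pi * A) := by positivity
      have g2 : 0 ≤ S * (2 * B') := by positivity
      nlinarith [mul_nonneg g1 f2, mul_nonneg g2 f1]

end Truncation

/-! ### Convolutions with measures of bounded density -/

section BoundedDensity

open scoped FourierTransform

variable {N : ℕ} {A B : ℝ} {K : EuclideanSpace ℝ (Fin N) → ℝ}

theorem exists_density_of_le {γ : Measure (EuclideanSpace ℝ (Fin N))} [IsFiniteMeasure γ] {c : ℝ}
    (hc : 0 ≤ c) (hγ : γ ≤ ENNReal.ofReal c • volume) :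
    ∃ g : EuclideanSpace ℝ (Fin N) → ℝ, Measurable g ∧ (∀ x, 0 ≤ g x) ∧ (∀ x, g x ≤ c) ∧
      γ = volume.withDensity fun x => ENNReal.ofReal (g x) := by
  have hac : γ ≪ volume := (Measure.absolutelyContinuous_of_le hγ).trans
    Measure.smul_absolutelyContinuous
  have hm : Measurable (γ.rnDeriv volume) := Measure.measurable_rnDeriv _ _
  have hle : γ.rnDeriv volume ≤ᵐ[volume] fun _ => ENNReal.ofReal c := by
    refine ae_le_of_forall_setLIntegral_le_of_sigmaFinite hm fun s hs _ => ?_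
    rw [Measure.setLIntegral_rnDeriv hac, setLIntegral_const]
    exact hγ s
  refine ⟨fun x => min (γ.rnDeriv volume x).toReal c, hm.ennreal_toReal.min measurable_const,
    fun x => le_min ENNReal.toReal_nonneg hc, fun x => min_le_right _ _, ?_⟩
  conv_lhs => rw [← Measure.withDensity_rnDeriv_eq _ _ hac]
  refine withDensity_congr_ae ?_
  filter_upwards [hle] with x hx
  have h1 : (γ.rnDeriv volume x).toReal ≤ c := ENNReal.toReal_le_of_le_ofReal hc hx
  rw [min_eq_left h1, ENNReal.ofReal_toReal (hx.trans_lt ENNReal.ofReal_lt_top).ne]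

theorem tendsto_lintegral_truncation_error {h : EuclideanSpace ℝ (Fin N) → ℝ≥0∞}
    (hm : Measurable h) (hh : ∫⁻ ξ, h ξ ^ 2 ≠ ∞) (Λ : ℝ≥0) :
    Tendsto (fun n : ℕ => ∫⁻ ξ, ENNReal.ofReal (Λ * min 2 ((‖ξ‖ + ‖ξ‖⁻¹) / (n + 1))) ^ 2 * h ξ ^ 2)
      atTop (𝓝 0) := by
  have h0 : (0 : ℝ≥0∞) = ∫⁻ _ : EuclideanSpace ℝ (Fin N), 0 := by simp
  rw [h0]
  refine tendsto_lintegral_of_dominated_convergence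
    (fun ξ => ENNReal.ofReal (Λ * 2) ^ 2 * h ξ ^ 2) (fun n => by fun_prop)
    (fun n => .of_forall fun ξ => ?_) ?_ ?_
  · exact mul_le_mul_left (pow_le_pow_left' (ENNReal.ofReal_le_ofReal
      (mul_le_mul_of_nonneg_left (min_le_left _ _) Λ.2)) 2) _
  · rw [lintegral_const_mul _ (hm.pow_const 2)]
    exact ENNReal.mul_ne_top (by finiteness) hh
  · have hfin : ∀ᵐ ξ, h ξ ^ 2 < ∞ := ae_lt_top (hm.pow_const 2) hh
    filter_upwards [hfin] with ξ hξ
    have h1 : Tendsto (fun n : ℕ => (‖ξ‖ + ‖ξ‖⁻¹) / ((n : ℝ) + 1)) atTop (𝓝 0) :=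
      tendsto_const_nhds.div_atTop (tendsto_atTop_add_const_right _ _ tendsto_natCast_atTop_atTop)
    have h2 : Tendsto (fun n : ℕ => (Λ : ℝ) * min 2 ((‖ξ‖ + ‖ξ‖⁻¹) / ((n : ℝ) + 1))) atTop
        (𝓝 0) := by
      have := (tendsto_const_nhds (x := (2 : ℝ))).min h1 |>.const_mul (Λ : ℝ)
      rwa [min_eq_right zero_le_two, mul_zero] at this
    have h3 := (ENNReal.continuous_ofReal.tendsto _).comp h2
    rw [ENNReal.ofReal_zero] at h3
    have h4 := ENNReal.Tendsto.mul_const (((ENNReal.continuous_pow 2).tendsto _).comp h3) (Or.inr hξ.ne)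
    simpa using h4

/-- The bound `b` on the Fourier multiplier is required only for `ξ ≠ 0`, since the bounds that are
used involve `‖ξ‖⁻¹`. -/
theorem lintegral_fderiv_convolution_sq_le_of_multiplier
    {J g : EuclideanSpace ℝ (Fin N) → ℝ} (hJ : ContDiff ℝ 2 J)
    (hJc : HasCompactSupport J) (hg : Integrable g) {b : EuclideanSpace ℝ (Fin N) → ℝ}
    (hb : ∀ ξ, ξ ≠ 0 → 2 * Real.pi * ‖ξ‖ * ‖𝓕 (fun x => (J x : ℂ)) ξ‖ ≤ b ξ) (hb0 : 0 ≤ b 0) :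
    ∫⁻ x, ‖fderiv ℝ (fun x => ∫ z, J (x - z) * g z) x‖ₑ ^ 2 ≤
      N * ∫⁻ ξ, ENNReal.ofReal (b ξ) ^ 2 * ‖𝓕 (fun x => (g x : ℂ)) ξ‖ₑ ^ 2 := by
  have h := lintegral_fderiv_convolution_sq_le (hJ.of_le one_le_two) hJc hg
  rw [finrank_euclideanSpace_fin] at h
  refine h.trans ?_
  gcongr with ξ
  rcases eq_or_ne ξ 0 with rfl | hξ
  · simpa using hb0
  · exact hb ξ hξ

/-- Off a small set, the convolution of a kernel with a function of `L¹ ∩ L^∞` is Lipschitz. The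
gradients of the convolutions with the truncated kernels form a Cauchy sequence in `L²`, so that the
Lipschitz estimates for the terms of a rapidly converging series can be summed. -/
theorem exists_enorm_integral_mul_sub_le (hN : 0 < N) {k : ℕ → EuclideanSpace ℝ (Fin N) → ℝ}
    {Λ : ℝ≥0} (hk : ∀ n, ContDiff ℝ 2 (k n)) (hkc : ∀ n, HasCompactSupport (k n))
    (hkΛ : ∀ n ξ, 2 * Real.pi * ‖ξ‖ * ‖𝓕 (fun x => (k n x : ℂ)) ξ‖ ≤ Λ)
    (hkd : ∀ n m, n ≤ m → ∀ ξ, ξ ≠ 0 →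
      2 * Real.pi * ‖ξ‖ * ‖𝓕 (fun x => ((k m x - k n x : ℝ) : ℂ)) ξ‖ ≤
        Λ * min 2 ((‖ξ‖ + ‖ξ‖⁻¹) / (n + 1)))
    {g : EuclideanSpace ℝ (Fin N) → ℝ} (hg : Integrable g) {c : ℝ} (hgc : ∀ x, ‖g x‖ ≤ c)
    {m : ℝ≥0∞} (hm0 : m ≠ 0) (hg2 : ∫⁻ x, ‖g x‖ₑ ^ 2 ≤ ENNReal.ofReal c * m) (hm : m ≠ ∞)
    {u : EuclideanSpace ℝ (Fin N) → ℝ}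
    (hu : ∀ x, Tendsto (fun n => ∫ z, k n (x - z) * g z) atTop (𝓝 (u x))) :
    ∃ G : Set (EuclideanSpace ℝ (Fin N)), MeasurableSet G ∧
      volume G ≤ ENNReal.ofReal (5 ^ N) * (N * Λ ^ 2 * ENNReal.ofReal c + 2) * m ∧
      ∀ x ∉ G, ∀ y ∉ G, ‖u x - u y‖ₑ ≤ ENNReal.ofReal (2 ^ (N + 2)) * 3 * ‖x - y‖ₑ := by
  have : Nonempty (Fin N) := ⟨⟨0, hN⟩⟩
  set h : EuclideanSpace ℝ (Fin N) → ℝ≥0∞ := fun ξ => ‖𝓕 (fun x => (g x : ℂ)) ξ‖ₑ with hh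
  have hgC : Integrable fun x => (g x : ℂ) := hg.ofReal
  have hmeas : Measurable h := (VectorFourier.fourierIntegral_continuous
    Real.continuous_fourierChar continuous_inner hgC).enorm.measurable
  have hplanch : ∫⁻ ξ, h ξ ^ 2 ≤ ENNReal.ofReal c * m := by
    have := lintegral_enorm_fourier_sq hgC (memLp_two_of_integrable_of_bounded hgC
      (c := c) fun x => by rw [Complex.norm_real]; exact hgc x)
    rw [hh, this]
    refine le_trans (le_of_eq (lintegral_congr fun x => ?_)) hg2
    rw [← ofReal_norm, Complex.norm_real, ofReal_norm]
  have hfin : ∫⁻ ξ, h ξ ^ 2 ≠ ∞ :=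
    (hplanch.trans_lt (ENNReal.mul_lt_top ENNReal.ofReal_lt_top hm.lt_top)).ne
  -- A subsequence along which the gradients converge rapidly in `L²`.
  set a : ℕ → ℝ≥0∞ := fun n =>
    ∫⁻ ξ, ENNReal.ofReal (Λ * min 2 ((‖ξ‖ + ‖ξ‖⁻¹) / (n + 1))) ^ 2 * h ξ ^ 2 with ha
  have hlim : Tendsto (fun n => N * a n) atTop (𝓝 0) := by
    have := ENNReal.Tendsto.const_mul (a := (N : ℝ≥0∞))
      (tendsto_lintegral_truncation_error hmeas hfin Λ) (Or.inr (ENNReal.natCast_ne_top N))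
    rwa [mul_zero] at this
  obtain ⟨φ, hφ, hφa⟩ := extraction_forall_of_eventually
    (P := fun j n => N * a n ≤ (8⁻¹ : ℝ≥0∞) ^ j * m) fun j =>
      hlim.eventually_le_const (ENNReal.mul_pos (pow_ne_zero _ (by simp)) hm0)
  have hφmono : ∀ j, φ j ≤ φ (j + 1) := fun j => (hφ (Nat.lt_succ_self j)).le
  -- The estimates of the first term and of the differences.
  have hk1 : ∀ n, ContDiff ℝ 1 (k n) := fun n => (hk n).of_le one_le_two
  set v : ℕ → EuclideanSpace ℝ (Fin N) → ℝ := fun n x => ∫ z, k n (x - z) * g z with hv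
  set w : ℕ → EuclideanSpace ℝ (Fin N) → ℝ :=
    fun j x => ∫ z, (k (φ (j + 1)) (x - z) - k (φ j) (x - z)) * g z with hw
  have hki : ∀ n x, Integrable fun z => k n (x - z) * g z := by
    intro n x
    obtain ⟨C, hC⟩ := (hk n).continuous.bounded_above_of_compact_support (hkc n)
    exact hg.bdd_mul ((hk n).continuous.comp (continuous_const.sub continuous_id)).aestronglyMeasurable
      (.of_forall fun z => hC _)
  have hwv : ∀ j x, w j x = v (φ (j + 1)) x - v (φ j) x := by
    intro j x
    simp only [hw, hv]
    rw [← integral_sub (hki _ _) (hki _ _)]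
    refine integral_congr_ae (.of_forall fun z => ?_)
    simp only
    ring
  have hdc : ∀ j, ContDiff ℝ 2 fun x => k (φ (j + 1)) x - k (φ j) x := fun j => (hk _).sub (hk _)
  have hdcc : ∀ j, HasCompactSupport fun x => k (φ (j + 1)) x - k (φ j) x :=
    fun j => (hkc _).sub (hkc _)
  have hE0 : ∫⁻ x, ‖fderiv ℝ (v (φ 0)) x‖ₑ ^ 2 ≤ N * Λ ^ 2 * ENNReal.ofReal c * m := by
    refine (lintegral_fderiv_convolution_sq_le_of_multiplier (hk _) (hkc _) hg (b := fun _ => Λ)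
      (fun ξ _ => hkΛ _ ξ) Λ.2).trans ?_
    rw [lintegral_const_mul _ (hmeas.pow_const 2), ENNReal.ofReal_coe_nnreal, mul_assoc, mul_assoc]
    gcongr
  have hE : ∀ j, ∫⁻ x, ‖fderiv ℝ (w j) x‖ₑ ^ 2 ≤ (8⁻¹ : ℝ≥0∞) ^ j * m := by
    intro j
    refine le_trans ?_ (hφa j)
    exact lintegral_fderiv_convolution_sq_le_of_multiplier (hdc j) (hdcc j) hg
      (b := fun ξ => Λ * min 2 ((‖ξ‖ + ‖ξ‖⁻¹) / (φ j + 1)))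
      (fun ξ hξ => hkd _ _ (hφmono j) ξ hξ) (by simp)
  obtain ⟨G₀, hG₀m, hG₀v, hG₀⟩ := exists_enorm_sub_le_off_small_set
    (contDiff_integral_sub_mul (hk1 (φ 0)) (hkc _) hg)
    (hE0.trans_lt (by finiteness)).ne one_pos
  have hG : ∀ j, ∃ G : Set (EuclideanSpace ℝ (Fin N)), MeasurableSet G ∧
      volume G ≤ ENNReal.ofReal (5 ^ N) * ((2⁻¹ : ℝ≥0∞) ^ j * m) ∧
      ∀ x ∉ G, ∀ y ∉ G,
        ‖w j x - w j y‖ₑ ≤ ENNReal.ofReal (2 ^ (N + 2)) * (2⁻¹ : ℝ≥0∞) ^ j * ‖x - y‖ₑ := by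
    intro j
    have hs : (0 : ℝ≥0) < (2⁻¹ : ℝ≥0) ^ j := by positivity
    obtain ⟨G, hGm, hGv, hG⟩ := exists_enorm_sub_le_off_small_set
      (contDiff_integral_sub_mul ((hdc j).of_le one_le_two) (hdcc j) hg)
      ((hE j).trans_lt (ENNReal.mul_lt_top (by finiteness) hm.lt_top)).ne hs
    have hcoe : (((2⁻¹ : ℝ≥0) ^ j : ℝ≥0) : ℝ≥0∞) = (2⁻¹ : ℝ≥0∞) ^ j := by
      rw [ENNReal.coe_pow, ENNReal.coe_inv two_ne_zero, ENNReal.coe_ofNat]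
    rw [finrank_euclideanSpace_fin, hcoe] at hGv
    simp only [finrank_euclideanSpace_fin, hcoe] at hG
    refine ⟨G, hGm, hGv.trans ?_, hG⟩
    gcongr
    refine ENNReal.div_le_of_le_mul ((hE j).trans_eq ?_)
    rw [mul_right_comm, ← pow_mul, mul_comm j 2, pow_mul, ← mul_pow]
    congr 2
    rw [← ENNReal.inv_pow, ← ENNReal.mul_inv (by simp) (by simp)]
    norm_num
  choose G hGm hGv hG using hG
  have hgeo : ∑' j : ℕ, (2⁻¹ : ℝ≥0∞) ^ j = 2 := by
    rw [ENNReal.tsum_geometric, ENNReal.one_sub_inv_two, inv_inv]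
  refine ⟨G₀ ∪ ⋃ j, G j, hG₀m.union (.iUnion hGm), ?_, fun x hx y hy => ?_⟩
  · rw [finrank_euclideanSpace_fin, ENNReal.coe_one, one_pow, div_one] at hG₀v
    calc volume (G₀ ∪ ⋃ j, G j) ≤ volume G₀ + ∑' j, volume (G j) :=
          (measure_union_le _ _).trans (add_le_add_right (measure_iUnion_le _) _)
      _ ≤ ENNReal.ofReal (5 ^ N) * (N * Λ ^ 2 * ENNReal.ofReal c * m) +
            ∑' j : ℕ, ENNReal.ofReal (5 ^ N) * ((2⁻¹ : ℝ≥0∞) ^ j * m) := by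
          refine add_le_add (hG₀v.trans (by gcongr)) (ENNReal.tsum_le_tsum hGv)
      _ = _ := by
          rw [ENNReal.tsum_mul_left, ENNReal.tsum_mul_right, hgeo]
          ring
  · simp only [mem_union, mem_iUnion, not_or, not_exists] at hx hy
    have h1 := hG₀ x hx.1 y hy.1
    rw [finrank_euclideanSpace_fin, ENNReal.coe_one, mul_one] at h1
    have hbound : ∀ J : ℕ, ‖v (φ J) x - v (φ J) y‖ₑ ≤ ENNReal.ofReal (2 ^ (N + 2)) *
        (1 + ∑ j ∈ Finset.range J, (2⁻¹ : ℝ≥0∞) ^ j) * ‖x - y‖ₑ := by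
      intro J
      induction J with
      | zero => simpa using h1
      | succ J ih =>
        have e : v (φ (J + 1)) x - v (φ (J + 1)) y =
            (v (φ J) x - v (φ J) y) + (w J x - w J y) := by
          rw [hwv, hwv]; ring
        rw [e]
        refine (enorm_add_le _ _).trans ((add_le_add ih (hG J x (hx.2 J) y (hy.2 J))).trans_eq ?_)
        rw [Finset.sum_range_succ]
        ring
    have hlimv : Tendsto (fun J => ‖v (φ J) x - v (φ J) y‖ₑ) atTop (𝓝 ‖u x - u y‖ₑ) :=
      (continuous_enorm.tendsto _).comp
        (((hu x).comp hφ.tendsto_atTop).sub ((hu y).comp hφ.tendsto_atTop))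
    refine le_of_tendsto' hlimv fun J => (hbound J).trans ?_
    gcongr
    calc 1 + ∑ j ∈ Finset.range J, (2⁻¹ : ℝ≥0∞) ^ j ≤ 1 + ∑' j : ℕ, (2⁻¹ : ℝ≥0∞) ^ j := by
          gcongr; exact ENNReal.sum_le_tsum _
      _ = 3 := by rw [hgeo]; norm_num

/-- Off a small set, the convolution of a kernel with a measure of bounded density is Lipschitz. -/
theorem exists_enorm_integral_sub_le_of_le_volume (hN : 0 < N) (hA : 0 ≤ A) (hB : 0 ≤ B) {c : ℝ}
    (hc : 0 ≤ c) :
    ∃ C : ℝ≥0, ∀ γ : Measure (EuclideanSpace ℝ (Fin N)), IsFiniteMeasure γ →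
      γ ≤ ENNReal.ofReal c • volume →
      ∀ K : EuclideanSpace ℝ (Fin N) → ℝ, IsKernel A B K →
      ∃ G : Set (EuclideanSpace ℝ (Fin N)), MeasurableSet G ∧ volume G ≤ C * γ univ ∧
        ∀ x ∉ G, ∀ y ∉ G, ‖(∫ z, K (x - z) ∂γ) - ∫ z, K (y - z) ∂γ‖ₑ ≤ C * ‖x - y‖ₑ := by
  have : Nonempty (Fin N) := ⟨⟨0, hN⟩⟩
  obtain ⟨Λ, hΛ⟩ := exists_truncations (N := N) hN hA hB
  set C₁ : ℝ≥0 := (5 : ℝ≥0) ^ N * (N * Λ ^ 2 * c.toNNReal + 2) with hC₁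
  set C₂ : ℝ≥0 := (2 : ℝ≥0) ^ (N + 2) * 3 with hC₂
  have hC₁' : (C₁ : ℝ≥0∞) = ENNReal.ofReal (5 ^ N) * (N * Λ ^ 2 * ENNReal.ofReal c + 2) := by
    rw [hC₁]
    push_cast
    rw [ENNReal.ofReal_pow (by norm_num), ENNReal.ofReal_ofNat]
    rfl
  have hC₂' : (C₂ : ℝ≥0∞) = ENNReal.ofReal (2 ^ (N + 2)) * 3 := by
    rw [hC₂]
    push_cast
    rw [ENNReal.ofReal_pow (by norm_num), ENNReal.ofReal_ofNat]
  refine ⟨C₁ + C₂, fun γ hγf hγ K hK => ?_⟩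
  rcases eq_or_ne (γ univ) 0 with h0 | h0
  · have : γ = 0 := Measure.measure_univ_eq_zero.1 h0
    exact ⟨∅, .empty, by simp, by simp [this]⟩
  obtain ⟨k, hk, hkc, hkK, hkl, hkΛ, hkd⟩ := hΛ K hK
  obtain ⟨g, hgm, hg0, hgc, hγg⟩ := exists_density_of_le hc hγ
  have hgu : ∫⁻ x, ENNReal.ofReal (g x) = γ univ := by
    rw [hγg, withDensity_apply _ MeasurableSet.univ, setLIntegral_univ]
  have hgi : Integrable g := by
    refine ⟨hgm.aestronglyMeasurable, ?_⟩
    rw [hasFiniteIntegral_iff_ofReal (.of_forall hg0), hgu]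
    exact measure_lt_top _ _
  have hint : ∀ F : EuclideanSpace ℝ (Fin N) → ℝ, ∫ z, F z ∂γ = ∫ z, F z * g z := by
    intro F
    rw [hγg]
    have := integral_withDensity_eq_integral_toReal_smul (μ := volume) (f := fun x => ENNReal.ofReal (g x))
      hgm.ennreal_ofReal (.of_forall fun x => ENNReal.ofReal_lt_top) F
    rw [this]
    refine integral_congr_ae (.of_forall fun z => ?_)
    simp only [smul_eq_mul]
    rw [ENNReal.toReal_ofReal (hg0 z), mul_comm]
  have hg2 : ∫⁻ x, ‖g x‖ₑ ^ 2 ≤ ENNReal.ofReal c * γ univ := by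
    rw [← hgu, ← lintegral_const_mul _ hgm.ennreal_ofReal]
    refine lintegral_mono fun x => ?_
    rw [← ofReal_norm, Real.norm_of_nonneg (hg0 x), sq]
    gcongr
    exact hgc x
  have hu : ∀ x, Tendsto (fun n => ∫ z, k n (x - z) * g z) atTop (𝓝 (∫ z, K (x - z) ∂γ)) := by
    intro x
    simp only [← hint]
    refine tendsto_integral_of_dominated_convergence (fun z => ‖K (x - z)‖)
      (fun n => ((hk n).continuous.comp
        (continuous_const.sub continuous_id)).aestronglyMeasurable)
      (hK.integrable_of_le_volume hN hA ENNReal.ofReal_ne_top hγ x).norm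
      (fun n => .of_forall fun z => hkK n _) ?_
    have hne : ∀ᵐ z ∂γ, z ≠ x := by
      have hac : γ ≪ volume := (Measure.absolutelyContinuous_of_le hγ).trans
        Measure.smul_absolutelyContinuous
      exact hac.ae_le (Measure.ae_ne volume x)
    filter_upwards [hne] with z hz
    exact tendsto_const_nhds.congr' ((hkl (x - z) (sub_ne_zero.2 hz.symm)).mono fun n hn => hn.symm)
  obtain ⟨G, hGm, hGv, hG⟩ := exists_enorm_integral_mul_sub_le hN hk hkc hkΛ hkd hgi
    (fun x => by rw [Real.norm_of_nonneg (hg0 x)]; exact hgc x) h0 hg2 (measure_ne_top γ univ) hu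
  rw [← hC₁'] at hGv
  rw [← hC₂'] at hG
  refine ⟨G, hGm, hGv.trans ?_, fun x hx y hy => (hG x hx y hy).trans ?_⟩
  · push_cast
    gcongr
    exact le_self_add
  · push_cast
    gcongr
    exact le_add_self

end BoundedDensity

/-! ### Lipschitz estimates for the convolution at every level -/

section Levels

variable {N : ℕ} {A B : ℝ} {K : EuclideanSpace ℝ (Fin N) → ℝ}

/-- The two halves of the Calderón–Zygmund argument combined: off a set of measure `≲ μ(ℝᴺ)`, both
the convolution with a measure `γ` of bounded density and the difference of the convolutions with
`μ` and `γ` are Lipschitz. -/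
theorem exists_enorm_integral_sub_le (hN : 0 < N) (hA : 0 ≤ A) (hB : 0 ≤ B) :
    ∃ C : ℝ≥0, 0 < C ∧ ∀ μ : Measure (EuclideanSpace ℝ (Fin N)), IsFiniteMeasure μ →
      ∀ K : EuclideanSpace ℝ (Fin N) → ℝ, IsKernel A B K →
      ∃ G : Set (EuclideanSpace ℝ (Fin N)), MeasurableSet G ∧ volume G ≤ C * μ univ ∧
        ∀ x ∉ G, ∀ y ∉ G, Integrable (fun z => K (x - z)) μ → Integrable (fun z => K (y - z)) μ →
          ‖(∫ z, K (x - z) ∂μ) - ∫ z, K (y - z) ∂μ‖ₑ ≤ C * ‖x - y‖ₑ := by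
  obtain ⟨C, hC⟩ := exists_enorm_integral_sub_le_of_le_volume hN hA hB
    (c := 5 ^ N + 1) (by positivity)
  set C₁ : ℝ≥0 := Real.toNNReal (30 ^ N) + sphereArea N
  set C₂ : ℝ≥0 := Real.toNNReal (2 ^ (2 * N + 4) * (A + B))
  refine ⟨C₁ + C₂ + C + 1, by positivity, fun μ hμ K hK => ?_⟩
  obtain ⟨G, γ, hGm, hGv, hγμ, hγ, hG⟩ := exists_bounded_density_replacement hN hA hB μ
  have hγf : IsFiniteMeasure γ := ⟨by rw [hγμ]; exact measure_lt_top _ _⟩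
  obtain ⟨G', hGm', hGv', hG'⟩ := hC γ hγf hγ K hK
  refine ⟨G ∪ G', hGm.union hGm', ?_, fun x hx y hy hxi hyi => ?_⟩
  · rw [hγμ] at hGv'
    calc volume (G ∪ G') ≤ (ENNReal.ofReal (30 ^ N) + sphereArea N) * μ univ + C * μ univ :=
          (measure_union_le _ _).trans (add_le_add hGv hGv')
      _ = (C₁ + C : ℝ≥0) * μ univ := by
          rw [← add_mul]
          push_cast
          rfl
      _ ≤ _ := by
          refine mul_le_mul_left (ENNReal.coe_le_coe.2 ?_) _
          calc C₁ + C ≤ C₁ + C + (C₂ + 1) := le_self_add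
            _ = _ := by ring
  · simp only [mem_union, not_or] at hx hy
    have h1 := hG K hK x hx.1 y hy.1 hxi hyi
    have h2 := hG' x hx.2 y hy.2
    have e : (∫ z, K (x - z) ∂μ) - ∫ z, K (y - z) ∂μ =
        (((∫ z, K (x - z) ∂μ) - ∫ z, K (x - z) ∂γ) - ((∫ z, K (y - z) ∂μ) - ∫ z, K (y - z) ∂γ)) +
          ((∫ z, K (x - z) ∂γ) - ∫ z, K (y - z) ∂γ) := by ring
    rw [e]
    calc _ ≤ (C₂ : ℝ≥0∞) * ‖x - y‖ₑ + C * ‖x - y‖ₑ :=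
          (enorm_add_le _ _).trans (add_le_add h1 h2)
      _ = (C₂ + C : ℝ≥0) * ‖x - y‖ₑ := by rw [← add_mul, ENNReal.coe_add]
      _ ≤ _ := by
          refine mul_le_mul_left (ENNReal.coe_le_coe.2 ?_) _
          calc C₂ + C ≤ C₂ + C + (C₁ + 1) := le_self_add
            _ = _ := by ring

/-- The estimate at level `t` is the estimate at a fixed level for a multiple of the measure. -/
theorem exists_enorm_integral_sub_le_mul (hN : 0 < N) (hA : 0 ≤ A) (hB : 0 ≤ B) :
    ∃ C : ℝ≥0, 0 < C ∧ ∀ μ : Measure (EuclideanSpace ℝ (Fin N)), IsFiniteMeasure μ →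
      ∀ K : EuclideanSpace ℝ (Fin N) → ℝ, IsKernel A B K → ∀ t : ℝ≥0, 0 < t →
      ∃ G : Set (EuclideanSpace ℝ (Fin N)), MeasurableSet G ∧ t * volume G ≤ C * μ univ ∧
        ∀ x ∉ G, ∀ y ∉ G, Integrable (fun z => K (x - z)) μ → Integrable (fun z => K (y - z)) μ →
          ‖(∫ z, K (x - z) ∂μ) - ∫ z, K (y - z) ∂μ‖ₑ ≤ t * ‖x - y‖ₑ := by
  obtain ⟨C, hC0, hC⟩ := exists_enorm_integral_sub_le (N := N) hN hA hB
  refine ⟨C * C, mul_pos hC0 hC0, fun μ hμ K hK t ht => ?_⟩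
  obtain ⟨G, hGm, hGv, hG⟩ := hC ((C / t) • μ) inferInstance K hK
  have hCt : (t : ℝ≥0∞) * ((C / t : ℝ≥0) : ℝ≥0∞) = C := by
    rw [← ENNReal.coe_mul, mul_div_cancel₀ _ ht.ne']
  refine ⟨G, hGm, ?_, fun x hx y hy hxi hyi => ?_⟩
  · calc (t : ℝ≥0∞) * volume G ≤ t * (C * ((C / t : ℝ≥0) * μ univ)) := by
          gcongr
          exact hGv
      _ = t * (C / t : ℝ≥0) * (C * μ univ) := by ring
      _ = _ := by rw [hCt, ENNReal.coe_mul, mul_assoc]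
  · have h := hG x hx y hy (hxi.smul_measure_nnreal) (hyi.smul_measure_nnreal)
    rw [integral_smul_nnreal_measure, integral_smul_nnreal_measure, ← smul_sub,
      NNReal.smul_def, smul_eq_mul, enorm_mul] at h
    have e : ‖((C / t : ℝ≥0) : ℝ)‖ₑ = ((C / t : ℝ≥0) : ℝ≥0∞) := by simp [enorm]
    rw [e] at h
    have hC0' : (C : ℝ≥0∞) ≠ 0 := by simpa using hC0.ne'
    refine (ENNReal.mul_le_mul_iff_right hC0' ENNReal.coe_ne_top).1 ?_
    calc _ = t * (((C / t : ℝ≥0) : ℝ≥0∞) * ‖(∫ z, K (x - z) ∂μ) - ∫ z, K (y - z) ∂μ‖ₑ) := by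
          rw [← mul_assoc, hCt]
      _ ≤ t * (C * ‖x - y‖ₑ) := by gcongr
      _ = _ := by ring

/-- On its domain, the convolution with a signed measure is the difference of the convolutions with
the two parts of the Jordan decomposition. -/
theorem IsKernel.integrable_and_conv_eq (hK : IsKernel A B K)
    {μ : SignedMeasure (EuclideanSpace ℝ (Fin N))} {x : EuclideanSpace ℝ (Fin N)}
    (hx : x ∈ convDom K μ) :
    Integrable (fun z => K (x - z)) μ.toJordanDecomposition.posPart ∧
      Integrable (fun z => K (x - z)) μ.toJordanDecomposition.negPart ∧
      conv K μ x = (∫ z, K (x - z) ∂μ.toJordanDecomposition.posPart) -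
        ∫ z, K (x - z) ∂μ.toJordanDecomposition.negPart := by
  have hm : Measurable fun z => K (x - z) := hK.measurable.comp (measurable_const.sub measurable_id)
  have hi : Integrable (fun z => K (x - z)) μ.totalVariation := ⟨hm.aestronglyMeasurable, hx⟩
  rw [SignedMeasure.totalVariation, integrable_add_measure] at hi
  refine ⟨hi.1, hi.2, ?_⟩
  have h : μ = μ.toJordanDecomposition.posPart.toSignedMeasure -
      μ.toJordanDecomposition.negPart.toSignedMeasure :=
    (SignedMeasure.toSignedMeasure_toJordanDecomposition μ).symm
  rw [conv]
  conv_lhs => rw [h]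
  rw [VectorMeasure.integral_sub_vectorMeasure, VectorMeasure.integral_toSignedMeasure,
    VectorMeasure.integral_toSignedMeasure]
  · rw [VectorMeasure.Integrable, Measure.variation_toSignedMeasure]
    exact hi.1
  · rw [VectorMeasure.Integrable, Measure.variation_toSignedMeasure]
    exact hi.2

theorem exists_enorm_conv_sub_le (hN : 0 < N) (hA : 0 ≤ A) (hB : 0 ≤ B) :
    ∃ C : ℝ≥0, 0 < C ∧ ∀ K : EuclideanSpace ℝ (Fin N) → ℝ, IsKernel A B K →
      ∀ μ : SignedMeasure (EuclideanSpace ℝ (Fin N)), ∀ t : ℝ≥0, 0 < t →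
      ∃ G : Set (EuclideanSpace ℝ (Fin N)), MeasurableSet G ∧
        t * volume G ≤ C * μ.totalVariation univ ∧
        ∀ x ∈ convDom K μ, x ∉ G → ∀ y ∈ convDom K μ, y ∉ G →
          ‖conv K μ x - conv K μ y‖ₑ ≤ t * ‖x - y‖ₑ := by
  obtain ⟨C, hC0, hC⟩ := exists_enorm_integral_sub_le_mul (N := N) hN hA hB
  refine ⟨2 * C, by positivity, fun K hK μ t ht => ?_⟩
  have ht2 : 0 < t / 2 := by positivity
  have htt : (t : ℝ≥0∞) = 2 * ((t / 2 : ℝ≥0) : ℝ≥0∞) := by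
    rw [← ENNReal.coe_ofNat, ← ENNReal.coe_mul, mul_div_cancel₀ _ two_ne_zero]
  obtain ⟨G, hGm, hGv, hG⟩ := hC μ.toJordanDecomposition.posPart inferInstance K hK _ ht2
  obtain ⟨G', hGm', hGv', hG'⟩ := hC μ.toJordanDecomposition.negPart inferInstance K hK _ ht2
  refine ⟨G ∪ G', hGm.union hGm', ?_, fun x hxD hx y hyD hy => ?_⟩
  · calc (t : ℝ≥0∞) * volume (G ∪ G') ≤ t * (volume G + volume G') := by
          gcongr; exact measure_union_le _ _
      _ = 2 * ((t / 2 : ℝ≥0) * volume G + (t / 2 : ℝ≥0) * volume G') := by rw [htt]; ring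
      _ ≤ 2 * (C * μ.toJordanDecomposition.posPart univ +
            C * μ.toJordanDecomposition.negPart univ) := by gcongr
      _ = _ := by
          rw [SignedMeasure.totalVariation, Measure.add_apply, ENNReal.coe_mul, ENNReal.coe_ofNat]
          ring
  · simp only [mem_union, not_or] at hx hy
    obtain ⟨hx1, hx2, hx3⟩ := hK.integrable_and_conv_eq hxD
    obtain ⟨hy1, hy2, hy3⟩ := hK.integrable_and_conv_eq hyD
    rw [hx3, hy3, sub_sub_sub_comm, htt, two_mul, add_mul]
    exact enorm_sub_le.trans (add_le_add (hG x hx.1 y hy.1 hx1 hy1) (hG' x hx.2 y hy.2 hx2 hy2))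

theorem IsKernel.ae_mem_convDom (hN : 0 < N) (hA : 0 ≤ A) (hK : IsKernel A B K)
    (μ : SignedMeasure (EuclideanSpace ℝ (Fin N))) : ∀ᵐ x, x ∈ convDom K μ :=
  hK.ae_lintegral_enorm_lt_top hN hA μ.totalVariation

end Levels

/-! ### From the levels to a weak `L¹` modulus -/

/-- If for every level `t` the function `u` is `t`-Lipschitz off a set of measure at most `M / t`,
then `u` is Lipschitz on the sublevel sets of a single function of weak `L¹`. -/
theorem exists_weakL1_modulus {N : ℕ} {D : Set (EuclideanSpace ℝ (Fin N))}
    {u : EuclideanSpace ℝ (Fin N) → ℝ} {M : ℝ≥0∞}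
    (h : ∀ t : ℝ≥0, 0 < t → ∃ G : Set (EuclideanSpace ℝ (Fin N)), MeasurableSet G ∧
      t * volume G ≤ M ∧ ∀ x ∈ D, x ∉ G → ∀ y ∈ D, y ∉ G → ‖u x - u y‖ₑ ≤ t * ‖x - y‖ₑ) :
    ∃ I : EuclideanSpace ℝ (Fin N) → ℝ≥0∞, Measurable I ∧ weakL1Norm I ≤ 4 * M ∧
      ∀ s : ℝ≥0, ∀ x ∈ D, I x < s → ∀ y ∈ D, I y < s → ‖u x - u y‖ₑ ≤ s * ‖x - y‖ₑ := by
  have h2 : ∀ k : ℤ, (0 : ℝ≥0) < 2 ^ k := fun k => by positivity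
  choose G hGm hGv hG using fun k : ℤ => h (2 ^ k) (h2 k)
  set E : ℤ → Set (EuclideanSpace ℝ (Fin N)) := fun k => ⋃ n : ℕ, G (k + n) with hE
  have hEm : ∀ k, MeasurableSet (E k) := fun k => .iUnion fun n => hGm _
  have hGE : ∀ k, G k ⊆ E k := fun k => by
    simpa using subset_iUnion (fun n : ℕ => G (k + n)) 0
  have hEanti : ∀ j k, j ≤ k → E k ⊆ E j := by
    intro j k hjk
    refine iUnion_subset fun n => ?_
    obtain ⟨i, rfl⟩ := Int.le.dest hjk
    have := subset_iUnion (fun n : ℕ => G (j + n)) (i + n)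
    push_cast at this
    rwa [← add_assoc] at this
  have hEv : ∀ k, ((2 ^ k : ℝ≥0) : ℝ≥0∞) * volume (E k) ≤ 2 * M := by
    intro k
    have hg : ∑' n : ℕ, (2⁻¹ : ℝ≥0∞) ^ n = 2 := by
      rw [ENNReal.tsum_geometric, ENNReal.one_sub_inv_two, inv_inv]
    calc ((2 ^ k : ℝ≥0) : ℝ≥0∞) * volume (E k)
        ≤ ((2 ^ k : ℝ≥0) : ℝ≥0∞) * ∑' n : ℕ, volume (G (k + n)) := by
          gcongr; exact measure_iUnion_le _
      _ = ∑' n : ℕ, ((2 ^ k : ℝ≥0) : ℝ≥0∞) * volume (G (k + n)) := ENNReal.tsum_mul_left.symm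
      _ ≤ ∑' n : ℕ, (2⁻¹ : ℝ≥0∞) ^ n * M := by
          refine ENNReal.tsum_le_tsum fun n => ?_
          have e : (2 ^ k : ℝ≥0) = 2⁻¹ ^ n * 2 ^ (k + n : ℤ) := by
            rw [zpow_add₀ two_ne_zero, zpow_natCast, mul_comm, mul_assoc, ← mul_pow,
              mul_inv_cancel₀ two_ne_zero, one_pow, mul_one]
          rw [e, ENNReal.coe_mul, mul_assoc, ENNReal.coe_pow, ENNReal.coe_inv two_ne_zero,
            ENNReal.coe_ofNat]
          gcongr
          exact hGv _
      _ = 2 * M := by rw [ENNReal.tsum_mul_right, hg]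
  -- The value `2^(k+1)` on `E k` is chosen such that `I < s` excludes the points of `E m` for the
  -- integer `m` with `2^m < s ≤ 2^(m+1)`.
  refine ⟨fun x => ⨆ k : ℤ, (E k).indicator (fun _ => ((2 ^ (k + 1) : ℝ≥0) : ℝ≥0∞)) x,
    .iSup fun k => measurable_const.indicator (hEm k), iSup₂_le fun t ht => ?_,
    fun s x hxD hx y hyD hy => ?_⟩
  · obtain ⟨m, hm1, hm2⟩ := exists_mem_Ico_zpow ht one_lt_two
    have hsub : {x | (t : ℝ≥0∞) <
        ⨆ k : ℤ, (E k).indicator (fun _ => ((2 ^ (k + 1) : ℝ≥0) : ℝ≥0∞)) x} ⊆ E m := by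
      intro x hx
      obtain ⟨k, hk⟩ := lt_iSup_iff.1 (mem_ofPred_eq ▸ hx :)
      by_cases hxk : x ∈ E k
      · rw [indicator_of_mem hxk, ENNReal.coe_lt_coe] at hk
        have := (zpow_lt_zpow_iff_right₀ (one_lt_two (α := ℝ≥0))).1 (hm1.trans_lt hk)
        exact hEanti m k (by omega) hxk
      · rw [indicator_of_notMem hxk] at hk
        exact absurd hk not_lt_zero
    calc (t : ℝ≥0∞) * volume _ ≤ ((2 ^ (m + 1) : ℝ≥0) : ℝ≥0∞) * volume (E m) :=
          mul_le_mul' (ENNReal.coe_le_coe.2 hm2.le) (measure_mono hsub)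
      _ = 2 * (((2 ^ m : ℝ≥0) : ℝ≥0∞) * volume (E m)) := by
          rw [zpow_add_one₀ two_ne_zero, ENNReal.coe_mul, ENNReal.coe_ofNat]; ring
      _ ≤ 2 * (2 * M) := mul_le_mul_right (hEv m) 2
      _ = 4 * M := by rw [← mul_assoc]; norm_num
  · have hs : 0 < s := by
      have := pos_of_gt hx
      exact_mod_cast this
    obtain ⟨m, hm1, hm2⟩ := exists_mem_Ioc_zpow hs one_lt_two
    have hnot : ∀ z, (⨆ k : ℤ, (E k).indicator (fun _ => ((2 ^ (k + 1) : ℝ≥0) : ℝ≥0∞)) z) < s →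
        z ∉ G m := by
      intro z hz hzm
      refine absurd (hz.trans_le (ENNReal.coe_le_coe.2 hm2)) (not_lt.2 ?_)
      refine le_iSup_of_le m ?_
      rw [indicator_of_mem (hGE m hzm)]
    refine (hG m x hxD (hnot x hx) y hyD (hnot y hy)).trans ?_
    gcongr

/-- The Lipschitz estimate on the sublevel sets is used with `s` slightly larger than `I x + I y`. -/
theorem enorm_sub_le_add_mul {N : ℕ} {D : Set (EuclideanSpace ℝ (Fin N))}
    {u : EuclideanSpace ℝ (Fin N) → ℝ} {I : EuclideanSpace ℝ (Fin N) → ℝ≥0∞}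
    (h : ∀ s : ℝ≥0, ∀ x ∈ D, I x < s → ∀ y ∈ D, I y < s → ‖u x - u y‖ₑ ≤ s * ‖x - y‖ₑ)
    {x y : EuclideanSpace ℝ (Fin N)} (hx : x ∈ D) (hy : y ∈ D) :
    ‖u x - u y‖ₑ ≤ (I x + I y) * ‖x - y‖ₑ := by
  rcases eq_or_ne x y with rfl | hxy
  · simp
  rcases eq_or_ne (I x + I y) ∞ with htop | htop
  · have h0 : ‖x - y‖ₑ ≠ 0 := by simpa [sub_eq_zero] using hxy
    rw [htop, ENNReal.top_mul h0]
    exact le_top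
  have hlim : Tendsto (fun n : ℕ => (I x + I y + (n + 1 : ℝ≥0∞)⁻¹) * ‖x - y‖ₑ) atTop
      (𝓝 ((I x + I y + 0) * ‖x - y‖ₑ)) := by
    refine ENNReal.Tendsto.mul_const (tendsto_const_nhds.add ?_) (Or.inr enorm_ne_top)
    have := (tendsto_add_atTop_iff_nat 1).2 ENNReal.tendsto_inv_nat_nhds_zero
    simpa using this
  rw [add_zero] at hlim
  refine ge_of_tendsto' hlim fun n => ?_
  have hpos : (0 : ℝ≥0∞) < (n + 1 : ℝ≥0∞)⁻¹ := by
    rw [ENNReal.inv_pos]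
    exact ENNReal.add_ne_top.2 ⟨ENNReal.natCast_ne_top n, ENNReal.one_ne_top⟩
  have hfin : I x + I y + (n + 1 : ℝ≥0∞)⁻¹ ≠ ∞ := by
    refine ENNReal.add_ne_top.2 ⟨htop, ENNReal.inv_ne_top.2 (by simp)⟩
  have hlt := ENNReal.lt_add_right htop hpos.ne'
  have := h (I x + I y + (n + 1 : ℝ≥0∞)⁻¹).toNNReal x hx
    (by rw [ENNReal.coe_toNNReal hfin]; exact le_self_add.trans_lt hlt) y hy
    (by rw [ENNReal.coe_toNNReal hfin]; exact le_add_self.trans_lt hlt)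
  rwa [ENNReal.coe_toNNReal hfin] at this

theorem ae_lt_top_of_weakL1Norm_lt_top {N : ℕ} {I : EuclideanSpace ℝ (Fin N) → ℝ≥0∞}
    (hI : weakL1Norm I < ∞) : ∀ᵐ y, I y < ∞ := by
  by_contra hcon
  have hv : volume {y | ¬ I y < ∞} ≠ 0 := hcon
  obtain ⟨n, hn⟩ := ENNReal.exists_nat_mul_gt hv hI.ne
  have hn0 : (0 : ℝ≥0) < n := by
    rcases Nat.eq_zero_or_pos n with rfl | h
    · simp at hn
    · exact_mod_cast h
  refine absurd hn (not_lt.2 (le_trans ?_ (le_iSup₂ (f := fun (t : ℝ≥0) (_ : 0 < t) =>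
    (t : ℝ≥0∞) * volume {x | (t : ℝ≥0∞) < I x}) (n : ℝ≥0) hn0)))
  rw [ENNReal.coe_natCast]
  refine mul_le_mul_right (measure_mono fun y hy => ?_) _
  rw [mem_ofPred_eq, not_lt_top_iff] at hy
  rw [mem_ofPred_eq, hy]
  exact ENNReal.natCast_lt_top n

/-! ### Density points and approximate derivatives -/

section Density

variable {N : ℕ} {S T D : Set (EuclideanSpace ℝ (Fin N))} {y : EuclideanSpace ℝ (Fin N)}

theorem ae_isDensityPoint (hS : MeasurableSet S) : ∀ᵐ y, y ∈ S → IsDensityPoint S y := by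
  filter_upwards [Besicovitch.ae_tendsto_measure_inter_div_of_measurableSet volume hS.compl]
    with y hy hyS
  rw [indicator_of_notMem (by simpa using hyS)] at hy
  refine tendsto_of_tendsto_of_tendsto_of_le_of_le' tendsto_const_nhds hy
    (.of_forall fun r => zero_le) ?_
  filter_upwards [self_mem_nhdsWithin] with r (hr : 0 < r)
  rw [Measure.addHaar_closedBall volume y hr.le, Measure.addHaar_ball_of_pos volume y hr]
  gcongr
  exact ball_subset_closedBall

/-- Being a density point is a local property, and is insensitive to null sets. -/
theorem IsDensityPoint.mono_ae (hS : IsDensityPoint S y) {δ : ℝ} (hδ : 0 < δ)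
    (h : ∀ᵐ x, x ∈ S → x ∈ ball y δ → x ∈ T) : IsDensityPoint T y := by
  refine tendsto_of_tendsto_of_tendsto_of_le_of_le' tendsto_const_nhds hS
    (.of_forall fun r => zero_le) ?_
  filter_upwards [Ioo_mem_nhdsGT hδ] with r hr
  gcongr 1
  refine measure_mono_ae ?_
  filter_upwards [h] with x hx hxT
  exact ⟨fun hxS => hxT.1 (hx hxS (ball_subset_ball hr.2.le hxT.2)), hxT.2⟩

theorem IsDensityPoint.inter (hS : IsDensityPoint S y) (hT : IsDensityPoint T y) :
    IsDensityPoint (S ∩ T) y := by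
  have h := Tendsto.add hS hT
  rw [add_zero] at h
  refine tendsto_of_tendsto_of_tendsto_of_le_of_le tendsto_const_nhds h
    (fun r => zero_le) fun r => ?_
  dsimp only
  rw [← ENNReal.add_div, compl_inter, union_inter_distrib_right]
  gcongr
  exact measure_union_le _ _

/-- A set contains points in almost any given direction from any of its density points. -/
theorem IsDensityPoint.exists_mem_norm_sub_le (hS : IsDensityPoint S y)
    {e : EuclideanSpace ℝ (Fin N)} (he : ‖e‖ = 1) {δ : ℝ} (hδ : 0 < δ) (hδ1 : δ ≤ 1) :
    ∃ r : ℝ, 0 < r ∧ ∃ x ∈ S, ‖x - y - r • e‖ ≤ δ * r := by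
  by_contra! hcon
  have hle : ∀ r : ℝ, 0 < r → ENNReal.ofReal ((δ / 2) ^ N) ≤
      volume (Sᶜ ∩ ball y r) / volume (ball y r) := by
    intro r hr
    have hb : volume (ball y r) ≠ 0 := (measure_ball_pos volume y hr).ne'
    rw [ENNReal.le_div_iff_mul_le (Or.inl hb) (Or.inl measure_ball_lt_top.ne)]
    have hv := Measure.addHaar_ball_mul_of_pos (volume : Measure (EuclideanSpace ℝ (Fin N)))
      (y + (r / 2) • e) (half_pos hδ) r
    rw [finrank_euclideanSpace_fin, ← Measure.addHaar_ball_center volume y r] at hv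
    rw [← hv]
    refine measure_mono fun x hx => ?_
    rw [mem_ball, dist_eq_norm, ← sub_sub] at hx
    refine ⟨fun hxS => absurd (hcon (r / 2) (half_pos hr) x hxS) (not_lt.2 ?_), ?_⟩
    · linarith
    · rw [mem_ball, dist_eq_norm]
      have h1 : ‖x - y‖ ≤ ‖x - y - (r / 2) • e‖ + ‖(r / 2) • e‖ := by
        simpa using norm_add_le (x - y - (r / 2) • e) ((r / 2) • e)
      rw [norm_smul, he, Real.norm_of_nonneg (half_pos hr).le] at h1
      nlinarith
  have h0 : ENNReal.ofReal ((δ / 2) ^ N) ≤ 0 := ge_of_tendsto hS (by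
    filter_upwards [self_mem_nhdsWithin] with r hr using hle r hr)
  rw [nonpos_iff_eq_zero, ENNReal.ofReal_eq_zero] at h0
  exact absurd h0 (not_le.2 (by positivity))

variable {u : EuclideanSpace ℝ (Fin N) → ℝ} {L : EuclideanSpace ℝ (Fin N) →L[ℝ] ℝ}

/-- An approximate derivative at a density point of a set on which the function is Lipschitz is
bounded by the Lipschitz constant: it can be tested on points of the set in almost any direction. -/
theorem HasApproxDeriv.norm_le (hL : HasApproxDeriv D u L y) (hS : IsDensityPoint S y) {s : ℝ≥0}
    (hu : ∀ x ∈ S, x ∈ D → ‖u x - u y‖ₑ ≤ s * ‖x - y‖ₑ) : ‖L‖ ≤ s := by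
  refine L.opNorm_le_of_unit_norm s.2 fun e he => ?_
  have key : ∀ δ : ℝ, 0 < δ → δ ≤ 1 → ‖L e‖ ≤ (s + δ) * (1 + δ) + ‖L‖ * δ := by
    intro δ hδ hδ1
    obtain ⟨r, hr, x, hx, hxr⟩ :=
      (hS.inter (hL.2 δ hδ)).exists_mem_norm_sub_le he hδ hδ1
    obtain ⟨hxS, hxD, hxL⟩ := hx
    have hn : ‖x - y‖ ≤ (1 + δ) * r := by
      have h1 : ‖x - y‖ ≤ ‖x - y - r • e‖ + ‖r • e‖ := by
        simpa using norm_add_le (x - y - r • e) (r • e)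
      rw [norm_smul, he, Real.norm_of_nonneg hr.le] at h1
      linarith
    have hux : |u x - u y| ≤ s * ‖x - y‖ := by
      have := hu x hxS hxD
      rw [enorm_eq_nnnorm, enorm_eq_nnnorm, ← ENNReal.coe_mul, ENNReal.coe_le_coe] at this
      exact_mod_cast this
    have hLx : |L (x - y)| ≤ (s + δ) * ‖x - y‖ := by
      rcases eq_or_ne (x - y) 0 with h0 | h0
      · simp [h0]
      · have hpos : 0 < ‖x - y‖ := norm_pos_iff.2 h0
        rw [sub_zero, abs_div, abs_of_pos hpos, div_le_iff₀ hpos] at hxL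
        rw [abs_le] at hxL hux ⊢
        constructor <;> linarith [hxL.1, hxL.2, hux.1, hux.2]
    have hLe : r * ‖L e‖ ≤ r * ((s + δ) * (1 + δ) + ‖L‖ * δ) := by
      have e1 : r * ‖L e‖ = ‖L (x - y) - L (x - y - r • e)‖ := by
        rw [← map_sub, sub_sub_cancel, map_smul, norm_smul, Real.norm_of_nonneg hr.le]
      rw [e1]
      calc _ ≤ ‖L (x - y)‖ + ‖L (x - y - r • e)‖ := norm_sub_le _ _
        _ ≤ (s + δ) * ((1 + δ) * r) + ‖L‖ * (δ * r) := by
            refine add_le_add (hLx.trans ?_) ((L.le_opNorm _).trans ?_)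
            · have : 0 ≤ (s : ℝ) + δ := by positivity
              gcongr
            · gcongr
        _ = _ := by ring
    exact le_of_mul_le_mul_left hLe hr
  have hlim : Tendsto (fun δ : ℝ => ((s : ℝ) + δ) * (1 + δ) + ‖L‖ * δ) (𝓝[>] 0)
      (𝓝 (((s : ℝ) + 0) * (1 + 0) + ‖L‖ * 0)) :=
    (Continuous.tendsto (by fun_prop) _).mono_left nhdsWithin_le_nhds
  simp only [add_zero, mul_one, mul_zero] at hlim
  refine ge_of_tendsto hlim ?_
  filter_upwards [Ioo_mem_nhdsGT one_pos] with δ hδ using key δ hδ.1 hδ.2.le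

/-- If `u` agrees with a function differentiable at `y` on a set with density point `y`, then `u` is
approximately differentiable at `y`. -/
theorem HasFDerivAt.hasApproxDeriv {g : EuclideanSpace ℝ (Fin N) → ℝ} (hg : HasFDerivAt g L y)
    (hS : IsDensityPoint S y) (hD : ∀ᵐ x, x ∈ D) (hyD : y ∈ D) (hy : u y = g y)
    (hu : ∀ x ∈ S, x ∈ D → u x = g x) : HasApproxDeriv D u L y := by
  refine ⟨hyD, fun ε hε => ?_⟩
  obtain ⟨δ, hδ, hball⟩ := Metric.eventually_nhds_iff_ball.1 (hg.isLittleO.def hε)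
  refine hS.mono_ae hδ ?_
  filter_upwards [hD] with x hxD hxS hxb
  refine ⟨hxD, ?_⟩
  have := hball x hxb
  rw [hu x hxS hxD, hy, sub_zero, abs_div, abs_norm]
  exact div_le_of_le_mul₀ (norm_nonneg _) hε.le this

/-- A function which is Lipschitz on the sublevel sets of `I` is approximately differentiable at
almost every point where `I` is finite, because its restrictions to the sublevel sets extend to
Lipschitz functions, which are differentiable almost everywhere. -/
theorem ae_hasApproxDeriv_of_lipschitz_sublevel {I : EuclideanSpace ℝ (Fin N) → ℝ≥0∞}
    (hI : Measurable I) (hIfin : ∀ᵐ y, I y < ∞) (hD : ∀ᵐ x, x ∈ D)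
    (h : ∀ s : ℝ≥0, ∀ x ∈ D, I x < s → ∀ y ∈ D, I y < s → ‖u x - u y‖ₑ ≤ s * ‖x - y‖ₑ) :
    ∀ᵐ y, (∃ L, HasApproxDeriv D u L y) ∧ ∀ L, HasApproxDeriv D u L y → ‖L‖ₑ ≤ I y := by
  have hdens : ∀ᵐ y, ∀ q : ℚ, I y < Real.toNNReal q →
      IsDensityPoint {x | I x < Real.toNNReal q} y :=
    ae_all_iff.2 fun q => ae_isDensityPoint (measurableSet_lt hI measurable_const)
  have hext : ∀ n : ℕ, ∃ g : EuclideanSpace ℝ (Fin N) → ℝ,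
      LipschitzWith (Real.toNNReal (n : ℚ)) g ∧
        EqOn u g {x | x ∈ D ∧ I x < Real.toNNReal (n : ℚ)} := by
    intro n
    refine LipschitzOnWith.extend_real fun x hx y hy => ?_
    rw [edist_eq_enorm_sub, edist_eq_enorm_sub]
    exact h _ x hx.1 hx.2 y hy.1 hy.2
  choose g hgL hg using hext
  have hdiff : ∀ᵐ y, ∀ n, DifferentiableAt ℝ (g n) y :=
    ae_all_iff.2 fun n => (hgL n).ae_differentiableAt
  filter_upwards [hdens, hdiff, hIfin, hD] with y hdens hdiff hIy hyD
  refine ⟨?_, fun L hL => le_of_not_gt fun hlt => ?_⟩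
  · obtain ⟨n, hn⟩ := ENNReal.exists_nat_gt hIy.ne
    have hn' : I y < Real.toNNReal (n : ℚ) := by simpa using hn
    exact ⟨_, HasFDerivAt.hasApproxDeriv (hdiff n).hasFDerivAt (hdens n hn') hD hyD
      (hg n ⟨hyD, hn'⟩) fun x hx hxD => hg n ⟨hxD, hx⟩⟩
  · obtain ⟨q, -, hq1, hq2⟩ := ENNReal.lt_iff_exists_rat_btwn.1 hlt
    refine absurd hq2 (not_lt.2 ?_)
    rw [enorm_eq_nnnorm, ENNReal.coe_le_coe, ← NNReal.coe_le_coe, coe_nnnorm]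
    exact hL.norm_le (hdens q hq1) fun x hx hxD => h _ x hxD hx y hyD hq1

end Density

end WeakL1

theorem mainTheorem2 (N : ℕ) (hN : 2 ≤ N) (A B : ℝ) (hA : 0 < A) (hB : 0 < B) :
    ∃ C : ℝ≥0, 0 < C ∧
      ∀ K : EuclideanSpace ℝ (Fin N) → ℝ, WeakL1.IsKernel A B K →
      ∀ μ : SignedMeasure (EuclideanSpace ℝ (Fin N)),
        ∃ I : EuclideanSpace ℝ (Fin N) → ℝ≥0∞,
          WeakL1.MemWeakL1 I ∧
          (∀ x ∈ WeakL1.convDom K μ, ∀ y ∈ WeakL1.convDom K μ,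
            ‖WeakL1.conv K μ x - WeakL1.conv K μ y‖ₑ ≤ (I x + I y) * ‖x - y‖ₑ) ∧
          WeakL1.weakL1Norm I ≤ C * μ.totalVariation univ ∧
          (∀ᵐ y, (∃ L, WeakL1.HasApproxDeriv (WeakL1.convDom K μ) (WeakL1.conv K μ) L y) ∧
            ∀ L, WeakL1.HasApproxDeriv (WeakL1.convDom K μ) (WeakL1.conv K μ) L y →
              ‖L‖ₑ ≤ 2 * I y) := by
  have hN0 : 0 < N := by omega
  obtain ⟨C, hC0, hC⟩ := WeakL1.exists_enorm_conv_sub_le (N := N) hN0 hA.le hB.le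
  refine ⟨4 * C, by positivity, fun K hK μ => ?_⟩
  obtain ⟨I, hIm, hIw, hI⟩ := WeakL1.exists_weakL1_modulus (hC K hK μ)
  have hfin : WeakL1.weakL1Norm I < ∞ := hIw.trans_lt
    (ENNReal.mul_lt_top (by simp) (ENNReal.mul_lt_top ENNReal.coe_lt_top (measure_lt_top _ _)))
  refine ⟨I, ⟨hIm, hfin⟩, fun x hx y hy => WeakL1.enorm_sub_le_add_mul hI hx hy, ?_, ?_⟩
  · rw [ENNReal.coe_mul, ENNReal.coe_ofNat, mul_assoc]
    exact hIw
  · filter_upwards [WeakL1.ae_hasApproxDeriv_of_lipschitz_sublevel hIm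
      (WeakL1.ae_lt_top_of_weakL1Norm_lt_top hfin) (hK.ae_mem_convDom hN0 hA.le μ) hI] with y hy
    exact ⟨hy.1, fun L hL => (hy.2 L hL).trans (le_mul_of_one_le_left' one_le_two)⟩
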